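/- Let $\ell$ be the set of finitely supported sequences $\alpha=(\alpha_1,\alpha_2,\dots)$ of non-negative integers, $z^\alpha=\prod_j z_j^{\alpha_j}$ and $(2\mathbb N)^{\alpha}=\prod_j (2j)^{\alpha_j}$. For $k\in\mathbb N$ let $\mathcal H'_k$ be the Hilbert space of power series $f=\sum_{\alpha\in\ell}f_\alpha z^\alpha$ with complex coefficients such that $\|f\|_k'^2=\sum_\alpha |f_\alpha|^2(2\mathbb N)^{-k\alpha}<\infty$, and let $\mathfrak R=\bigcup_k\mathcal H'_k$. With the product of power series this is a commutative ring, the image of the Kondratiev space $S_{-1}$ with the Wick product under the Hermite transform $\sum f_\alpha H_\alpha\mapsto\sum f_\alpha z^\alpha$. For $\mathbf r=\sum r_\alpha z^\alpha\in\mathfrak R$ put $E(\mathbf r)=\mathbf r(0)$ and $\mathbf r^*=\sum\overline{r_\alpha}z^\alpha$; the adjoint of a matrix over $\mathfrak R$ is the transpose with $*$ applied to the entries. A matrix $\mathbf M\in\mathfrak R^{n\times n}$ is strictly positive, $\mathbf M>0$, if $\mathbf M=\mathbf G\mathbf G^*$ with $\mathbf G\in\mathfrak R^{n\times n}$ invertible.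 Let $\mathbb D$ be the open unit disk and $\mathfrak R_{\mathbb D}=\{\mathbf r\in\mathfrak R:\ E(\mathbf r)\in\mathbb D\}$. A function $\mathbf f:\mathbb D\to\mathfrak R$ is analytic if around every $\zeta_0\in\mathbb D$ it has a Taylor expansion $\mathbf f(\zeta)=\sum_{m\ge0}\mathbf f_m(\zeta-\zeta_0)^m$ converging in some $\mathcal H'_p$ for $\zeta$ near $\zeta_0$ (with $p$ depending on $\zeta_0$). For $\mathbf r\in\mathfrak R_{\mathbb D}$ its value at $\mathbf r$ is $\mathbf f(\mathbf r)=\sum_{m\ge 0}\mathbf f_m(\mathbf r-E(\mathbf r))^m$, convergent in some $\mathcal H'_q$, where $\mathbf f_m$ are the Taylor coefficients of $\mathbf f$ around $E(\mathbf r)$. An analytic $\mathbf f:\mathbb D\to\mathfrak R$ is a Schur function, $\mathbf f\in S_{\mathfrak R}$, if $|E(\mathbf f(\lambda))|\le 1$ for all $\lambda\in\mathbb D$. Let $\mathbf a_1,\dots,\mathbf a_n,\mathbf b_1,\dots,\mathbf b_n\in\mathfrak R_{\mathbb D}$, and set $$\mathbf P=\Big((1-\mathbf b_i\mathbf b_j^*)(1-\mathbf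 a_i\mathbf a_j^*)^{-1}\Big)_{i,j=1}^n,\quad \mathbf A=\mathrm{diag}(\mathbf a_1^*,\dots,\mathbf a_n^*),\quad \mathbf C=\begin{pmatrix}1&\cdots&1\\ \mathbf b_1^*&\cdots&\mathbf b_n^*\end{pmatrix},\quad J=\begin{pmatrix}1&0\\0&-1\end{pmatrix},$$ $$\mathbf\Theta(\lambda)=I_2-(1-\lambda)\,\mathbf C(I_n-\lambda\mathbf A)^{-1}\mathbf P^{-1}\big((I_n-\mathbf A)^{*}\big)^{-1}\mathbf C^*J=\begin{pmatrix}\mathbf a(\lambda)&\mathbf b(\lambda)\\ \mathbf c(\lambda)&\mathbf d(\lambda)\end{pmatrix},\qquad \lambda\in\mathbb D.$$ **Theorem.** Assume $\mathbf P>0$. Then all the inverses above exist, $\mathbf c(\lambda)\mathbf g(\lambda)+\mathbf d(\lambda)$ is invertible in $\mathfrak R$ for all $\mathbf g\in S_{\mathfrak R}$ and $\lambda\in\mathbb D$, and the linear fractional transformation $$\mathbf g\mapsto T_{\mathbf\Theta}(\mathbf g)=(\mathbf a\,\mathbf g+\mathbf b)(\mathbf c\,\mathbf g+\mathbf d)^{-1}$$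 is a one-to-one correspondence from $S_{\mathfrak R}$ onto the set of all $\mathbf f\in S_{\mathfrak R}$ such that $\mathbf f(\mathbf a_i)=\mathbf b_i$ for $i=1,\dots,n$. -/

import Mathlib

open scoped Topology Ring

noncomputable section

namespace Kondratiev

/-! ### The weights and the Hilbert spaces of power series -/

/-- The weight `(2ℕ)^α = ∏_j (2j)^{α_j}` of a multi-index `α ∈ ℓ`. The variables `z₁, z₂, …` are
indexed here by `0, 1, …`, so that the variable with index `j` carries the base `2 (j + 1)`. -/
def wt (α : ℕ →₀ ℕ) : ℝ := α.prod fun j m => (2 * ((j : ℝ) + 1)) ^ m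

theorem wt_add (α β : ℕ →₀ ℕ) : wt (α + β) = wt α * wt β := by
  unfold wt
  exact Finsupp.prod_add_index' (by simp) (by intros; rw [pow_add])

theorem one_le_wt (α : ℕ →₀ ℕ) : 1 ≤ wt α := by
  unfold wt Finsupp.prod
  have h : ∀ s : Finset ℕ, 1 ≤ ∏ j ∈ s, (2 * ((j : ℝ) + 1)) ^ α j := by
    intro s
    refine Finset.prod_induction _ (fun x : ℝ => 1 ≤ x) (fun _ _ => one_le_mul_of_one_le_of_one_le)
      le_rfl fun j _ => one_le_pow₀ ?_
    have : (0 : ℝ) ≤ j := Nat.cast_nonneg j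
    linarith
  exact h _

theorem wt_pos (α : ℕ →₀ ℕ) : 0 < wt α := lt_of_lt_of_le one_pos (one_le_wt α)

theorem wt_zero : wt 0 = 1 := by simp [wt]

theorem summable_aux : Summable fun j : ℕ => (2 : ℝ) * ((2 * ((j : ℝ) + 1)) ^ 2)⁻¹ := by
  have h : Summable fun j : ℕ => (((j : ℝ) + 1) ^ 2)⁻¹ := by
    have := (summable_nat_add_iff 1).2 (Real.summable_nat_pow_inv (p := 2).2 (by norm_num))
    simpa using this
  refine (h.mul_left (1 / 2)).congr fun j => ?_
  have : ((j : ℝ) + 1) ≠ 0 := by positivity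
  field_simp

/-- The series of the inverse squared weights converges. -/
theorem summable_wt : Summable fun α : ℕ →₀ ℕ => (wt α ^ 2)⁻¹ := by
  set x : ℕ → ℝ := fun j => ((2 * ((j : ℝ) + 1)) ^ 2)⁻¹ with hx
  have hx0 : ∀ j, 0 ≤ x j := fun j => by simp only [hx]; positivity
  have hx1 : ∀ j, x j ≤ 1 / 4 := fun j => by
    simp only [hx]
    rw [one_div]
    refine inv_anti₀ (by norm_num) ?_
    have : (0 : ℝ) ≤ j := Nat.cast_nonneg j
    nlinarith
  refine summable_of_sum_le (c := Real.exp (∑' j, 2 * x j))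
    (fun α => inv_nonneg.2 (pow_nonneg (wt_pos α).le 2)) fun S => ?_
  obtain ⟨N, hN⟩ : ∃ N, ∀ α ∈ S, α.support ⊆ Finset.range N := by
    obtain ⟨N, hN⟩ := (S.biUnion fun α => α.support).exists_nat_subset_range
    exact ⟨N, fun α hα => (Finset.subset_biUnion_of_mem (fun α => α.support) hα).trans hN⟩
  obtain ⟨M, hM⟩ : ∃ M, ∀ α ∈ S, ∀ j, α j < M := by
    refine ⟨(S.sup fun α => α.sum fun _ m => m) + 1, fun α hα j => Nat.lt_succ_of_le ?_⟩
    refine le_trans ?_ (Finset.le_sup (f := fun α : ℕ →₀ ℕ => α.sum fun _ m => m) hα)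
    by_cases hj : j ∈ α.support
    · exact Finset.single_le_sum (f := fun j => α j) (fun _ _ => Nat.zero_le _) hj
    · simp [Finsupp.notMem_support_iff.1 hj]
  have hterm : ∀ α ∈ S, (wt α ^ 2)⁻¹ = ∏ i : Fin N, x i ^ α i := by
    intro α hα
    rw [wt, Finsupp.prod_of_support_subset α (hN α hα) _ (by simp), ← Finset.prod_pow,
      ← Finset.prod_inv_distrib, Finset.prod_range]
    refine Finset.prod_congr rfl fun i _ => ?_
    simp only [hx]
    rw [inv_pow, ← pow_mul, ← pow_mul, mul_comm (α i)]
  have hinj : Set.InjOn (fun (α : ℕ →₀ ℕ) (i : Fin N) => α i) S := by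
    intro α hα β hβ h
    ext j
    by_cases hj : j < N
    · exact congrFun h ⟨j, hj⟩
    · have h1 : j ∉ α.support := fun h' => hj (Finset.mem_range.1 (hN α hα h'))
      have h2 : j ∉ β.support := fun h' => hj (Finset.mem_range.1 (hN β hβ h'))
      rw [Finsupp.notMem_support_iff.1 h1, Finsupp.notMem_support_iff.1 h2]
  calc ∑ α ∈ S, (wt α ^ 2)⁻¹ = ∑ α ∈ S, ∏ i : Fin N, x i ^ α i := Finset.sum_congr rfl hterm
    _ = ∑ p ∈ S.image (fun (α : ℕ →₀ ℕ) (i : Fin N) => α i), ∏ i : Fin N, x i ^ p i := by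
        rw [Finset.sum_image hinj]
    _ ≤ ∑ p ∈ Fintype.piFinset fun _ : Fin N => Finset.range M, ∏ i : Fin N, x i ^ p i := by
        refine Finset.sum_le_sum_of_subset_of_nonneg ?_ fun p _ _ =>
          Finset.prod_nonneg fun i _ => pow_nonneg (hx0 i) _
        intro p hp
        obtain ⟨α, hα, rfl⟩ := Finset.mem_image.1 hp
        exact Fintype.mem_piFinset.2 fun i => Finset.mem_range.2 (hM α hα i)
    _ = ∏ i : Fin N, ∑ m ∈ Finset.range M, x i ^ m :=
        (Finset.prod_univ_sum (fun _ : Fin N => Finset.range M) fun i m => x i ^ m).symm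
    _ ≤ ∏ i : Fin N, Real.exp (2 * x i) := by
        refine Finset.prod_le_prod (fun i _ => Finset.sum_nonneg fun m _ => pow_nonneg (hx0 i) _)
          fun i _ => ?_
        have h1 : ∑ m ∈ Finset.range M, x i ^ m ≤ (1 - x i)⁻¹ := by
          rw [← tsum_geometric_of_lt_one (hx0 i) (by linarith [hx1 i])]
          exact (summable_geometric_of_lt_one (hx0 i) (by linarith [hx1 i])).sum_le_tsum _
            fun m _ => pow_nonneg (hx0 i) _
        have h2 : (1 - x i)⁻¹ ≤ 1 + 2 * x i := by
          rw [inv_le_iff_one_le_mul₀ (by linarith [hx1 i])]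
          nlinarith [hx0 i, hx1 i]
        linarith [Real.add_one_le_exp (2 * x i)]
    _ = Real.exp (∑ i ∈ Finset.range N, 2 * x i) := by
        rw [Real.exp_sum, Finset.prod_range]
    _ ≤ Real.exp (∑' j, 2 * x j) :=
        Real.exp_le_exp.2 (summable_aux.sum_le_tsum _ fun j _ => mul_nonneg (by norm_num) (hx0 j))

/-- The space `I(𝓗'_k)`: the power series `f = ∑ f_α z^α` in countably many variables with complex
coefficients such that `∑_α |f_α|² (2ℕ)^{-kα} < ∞`. The Hermite transform `I` sends
`∑ f_α H_α` to `∑ f_α z^α`, so it is the identity on coefficient sequences and turns the Wick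
product into the product of power series. -/
def H (k : ℕ) : Submodule ℂ (MvPowerSeries ℕ ℂ) where
  carrier := {f | Summable fun α => ‖MvPowerSeries.coeff α f‖ ^ 2 * (wt α ^ k)⁻¹}
  zero_mem' := by simp [summable_zero]
  add_mem' := by
    intro f g hf hg
    refine Summable.of_nonneg_of_le (fun α => ?_) (fun α => ?_)
      ((Summable.add hf hg).mul_left 2)
    · have := wt_pos α
      positivity
    · have hw : 0 ≤ (wt α ^ k)⁻¹ := inv_nonneg.2 (pow_nonneg (wt_pos α).le k)
      have h1 : ‖MvPowerSeries.coeff α (f + g)‖ ^ 2 ≤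
          2 * (‖MvPowerSeries.coeff α f‖ ^ 2 + ‖MvPowerSeries.coeff α g‖ ^ 2) := by
        rw [map_add]
        have := norm_add_le (MvPowerSeries.coeff α f) (MvPowerSeries.coeff α g)
        nlinarith [norm_nonneg (MvPowerSeries.coeff α f + MvPowerSeries.coeff α g),
          sq_nonneg (‖MvPowerSeries.coeff α f‖ - ‖MvPowerSeries.coeff α g‖)]
      calc _ ≤ 2 * (‖MvPowerSeries.coeff α f‖ ^ 2 + ‖MvPowerSeries.coeff α g‖ ^ 2)
            * (wt α ^ k)⁻¹ := mul_le_mul_of_nonneg_right h1 hw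
        _ = _ := by ring
  smul_mem' := by
    intro c f hf
    refine (Summable.mul_left (‖c‖ ^ 2) hf).congr fun α => ?_
    rw [MvPowerSeries.coeff_smul, norm_mul]
    ring

theorem mem_H {k : ℕ} {f : MvPowerSeries ℕ ℂ} :
    f ∈ H k ↔ Summable fun α => ‖MvPowerSeries.coeff α f‖ ^ 2 * (wt α ^ k)⁻¹ := Iff.rfl

/-- The weighted coefficients `f_α (2ℕ)^{-kα/2}`, as an element of `ℓ²`. -/
def toL2 (k : ℕ) : H k →ₗ[ℂ] lp (fun _ : ℕ →₀ ℕ => ℂ) 2 where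
  toFun f := ⟨fun α => ((Real.sqrt (wt α ^ k)⁻¹ : ℝ) : ℂ) * MvPowerSeries.coeff α f.1, by
    refine memℓp_gen ?_
    refine (mem_H.1 f.2).congr fun α => ?_
    have hw : 0 ≤ (wt α ^ k)⁻¹ := inv_nonneg.2 (pow_nonneg (wt_pos α).le k)
    rw [norm_mul, Complex.norm_real, Real.norm_of_nonneg (Real.sqrt_nonneg _)]
    rw [show (2 : ENNReal).toReal = ((2 : ℕ) : ℝ) by simp, Real.rpow_natCast, mul_pow,
      Real.sq_sqrt hw, mul_comm]⟩
  map_add' f g := by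
    ext α
    simp only [Submodule.coe_add, map_add, mul_add]
    rfl
  map_smul' c f := by
    ext α
    simp only [Submodule.coe_smul, RingHom.id_apply, lp.coeFn_smul, Pi.smul_apply, smul_eq_mul]
    rw [MvPowerSeries.coeff_smul]
    ring

theorem toL2_apply (k : ℕ) (f : H k) (α : ℕ →₀ ℕ) :
    toL2 k f α = ((Real.sqrt (wt α ^ k)⁻¹ : ℝ) : ℂ) * MvPowerSeries.coeff α f.1 := rfl

theorem toL2_injective (k : ℕ) : Function.Injective (toL2 k) := by
  intro f g h
  apply Subtype.ext
  ext α
  have h1 := congrArg (fun u : lp (fun _ : ℕ →₀ ℕ => ℂ) 2 => u α) h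
  simp only [toL2_apply] at h1
  refine mul_left_cancel₀ ?_ h1
  have : 0 < (wt α ^ k)⁻¹ := inv_pos.2 (pow_pos (wt_pos α) k)
  exact_mod_cast (Real.sqrt_pos.2 this).ne'

/-- The norm `‖f‖'_k = (∑_α |f_α|² (2ℕ)^{-kα})^{1/2}`; see `norm_sq_eq`. -/
instance (k : ℕ) : NormedAddCommGroup (H k) :=
  NormedAddCommGroup.induced (H k) (lp (fun _ : ℕ →₀ ℕ => ℂ) 2) (toL2 k) (toL2_injective k)

instance (k : ℕ) : NormedSpace ℂ (H k) :=
  NormedSpace.induced ℂ (H k) (lp (fun _ : ℕ →₀ ℕ => ℂ) 2) (toL2 k)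

theorem norm_sq_eq (k : ℕ) (f : H k) :
    ‖f‖ ^ 2 = ∑' α, ‖MvPowerSeries.coeff α f.1‖ ^ 2 * (wt α ^ k)⁻¹ := by
  have h : ‖f‖ = ‖toL2 k f‖ := rfl
  have h2 := lp.norm_rpow_eq_tsum (p := 2) (by simp) (toL2 k f)
  rw [show (2 : ENNReal).toReal = ((2 : ℕ) : ℝ) by simp] at h2
  simp only [Real.rpow_natCast] at h2
  rw [h, h2]
  refine tsum_congr fun α => ?_
  have hw : 0 ≤ (wt α ^ k)⁻¹ := inv_nonneg.2 (pow_nonneg (wt_pos α).le k)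
  rw [toL2_apply, norm_mul, Complex.norm_real, Real.norm_of_nonneg (Real.sqrt_nonneg _), mul_pow,
      Real.sq_sqrt hw, mul_comm]

theorem H_mono {k l : ℕ} (h : k ≤ l) : H k ≤ H l := by
  intro f hf
  refine Summable.of_nonneg_of_le (fun α => ?_) (fun α => ?_) (mem_H.1 hf)
  · have := wt_pos α
    positivity
  · have := wt_pos α
    have h1 := pow_le_pow_right₀ (one_le_wt α) h
    gcongr

theorem summable_norm_of_mem {k : ℕ} {f : MvPowerSeries ℕ ℂ} (hf : f ∈ H k) {m : ℕ}
    (hm : k + 1 ≤ m) : Summable fun α => ‖MvPowerSeries.coeff α f‖ * (wt α ^ m)⁻¹ := by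
  refine Summable.of_nonneg_of_le (fun α => ?_) (fun α => ?_) ((mem_H.1 hf).add summable_wt)
  · have := wt_pos α
    positivity
  · have hw := wt_pos α
    have h1 : (wt α ^ m)⁻¹ ≤ (wt α ^ (k + 1))⁻¹ := by
      have := pow_le_pow_right₀ (one_le_wt α) hm
      gcongr
    set v := (wt α)⁻¹ with hv
    have hv0 : 0 < v := inv_pos.2 hw
    have hv1 : v ^ k ≤ 1 := pow_le_one₀ hv0.le (inv_le_one_of_one_le₀ (one_le_wt α))
    have hvk : 0 < v ^ k := pow_pos hv0 k
    set c := ‖MvPowerSeries.coeff α f‖ with hc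
    have hc0 : 0 ≤ c := norm_nonneg _
    simp only [← inv_pow, ← hv] at h1 ⊢
    calc c * v ^ m ≤ c * v ^ (k + 1) := mul_le_mul_of_nonneg_left h1 hc0
      _ = v ^ k * (c * v) := by ring
      _ ≤ v ^ k * (c ^ 2 + v ^ 2) := by
          refine mul_le_mul_of_nonneg_left ?_ hvk.le
          nlinarith [sq_nonneg (c - v)]
      _ = c ^ 2 * v ^ k + v ^ k * v ^ 2 := by ring
      _ ≤ c ^ 2 * v ^ k + v ^ 2 := by nlinarith [sq_nonneg v]

theorem mem_of_summable_norm {f : MvPowerSeries ℕ ℂ} {m : ℕ}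
    (hf : Summable fun α => ‖MvPowerSeries.coeff α f‖ * (wt α ^ m)⁻¹) : f ∈ H (2 * m) := by
  refine mem_H.2 ?_
  refine Summable.of_norm_bounded_eventually hf ?_
  filter_upwards [hf.tendsto_cofinite_zero.eventually (gt_mem_nhds one_pos)] with α hα
  have hw := wt_pos α
  have h0 : 0 ≤ ‖MvPowerSeries.coeff α f‖ * (wt α ^ m)⁻¹ := by positivity
  have h1 : ‖MvPowerSeries.coeff α f‖ ^ 2 * (wt α ^ (2 * m))⁻¹ =
      (‖MvPowerSeries.coeff α f‖ * (wt α ^ m)⁻¹) ^ 2 := by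
    rw [mul_pow, inv_pow, ← pow_mul, mul_comm m 2]
  rw [h1, Real.norm_of_nonneg (by positivity)]
  nlinarith

theorem mul_mem_H {k l : ℕ} {f g : MvPowerSeries ℕ ℂ} (hf : f ∈ H k) (hg : g ∈ H l) :
    f * g ∈ H (2 * (k + l + 1)) := by
  have h1 := summable_norm_of_mem hf (m := k + l + 1) (by omega)
  have h2 := summable_norm_of_mem hg (m := k + l + 1) (by omega)
  generalize k + l + 1 = m at h1 h2 ⊢
  refine mem_of_summable_norm ?_
  have h3 := summable_sum_mul_antidiagonal_of_summable_mul
    (f := fun α => ‖MvPowerSeries.coeff α f‖ * (wt α ^ m)⁻¹)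
    (g := fun α => ‖MvPowerSeries.coeff α g‖ * (wt α ^ m)⁻¹)
    (h1.mul_of_nonneg h2 (fun α => by have := wt_pos α; positivity)
      (fun α => by have := wt_pos α; positivity))
  refine Summable.of_nonneg_of_le (fun α => ?_) (fun α => ?_) h3
  · have := wt_pos α
    positivity
  · have hw := wt_pos α
    rw [MvPowerSeries.coeff_mul]
    refine (mul_le_mul_of_nonneg_right (norm_sum_le _ _)
      (inv_nonneg.2 (pow_nonneg hw.le m))).trans (le_of_eq ?_)
    rw [Finset.sum_mul]
    refine Finset.sum_congr rfl fun p hp => ?_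
    rw [← Finset.HasAntidiagonal.mem_antidiagonal.1 hp, wt_add, mul_pow, mul_inv, norm_mul]
    ring

/-! ### The ring `𝔑` -/

/-- The ring `𝔑 = ⋃_k I(𝓗'_k)`, the image of the Kondratiev space `S_{-1} = ⋃_k 𝓗'_k` with the
Wick product under the Hermite transform, as a subalgebra of the power series in countably many
variables. -/
def hermiteImage : Subalgebra ℂ (MvPowerSeries ℕ ℂ) where
  carrier := {f | ∃ k, f ∈ H k}
  mul_mem' := by
    rintro f g ⟨k, hf⟩ ⟨l, hg⟩
    exact ⟨_, mul_mem_H hf hg⟩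
  add_mem' := by
    rintro f g ⟨k, hf⟩ ⟨l, hg⟩
    exact ⟨k + l, (H (k + l)).add_mem (H_mono (by omega) hf) (H_mono (by omega) hg)⟩
  algebraMap_mem' c := by
    refine ⟨0, mem_H.2 (summable_of_ne_finset_zero (s := {0}) fun α hα => ?_)⟩
    have hα' : α ≠ 0 := by simpa using hα
    rw [MvPowerSeries.algebraMap_apply, MvPowerSeries.coeff_C, if_neg hα']
    simp

/-- The type of elements of the ring `𝔑`. -/
abbrev N : Type := hermiteImage

/-- The evaluation at the origin `E(r) = r(0)`. -/
def E : N →+* ℂ := (MvPowerSeries.constantCoeff (σ := ℕ) (R := ℂ)).comp hermiteImage.val.toRingHom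

/-- The involution `r ↦ r*`, which conjugates the coefficients. With it, `Matrix.conjTranspose` is
the adjoint of a matrix with entries in `𝔑`. -/
instance : StarRing N where
  star r := ⟨MvPowerSeries.map (starRingEnd ℂ) r.1, by
    obtain ⟨k, hk⟩ := r.2
    refine ⟨k, mem_H.2 ?_⟩
    simpa using mem_H.1 hk⟩
  star_involutive r := by
    apply Subtype.ext
    ext α
    simp
  star_mul r s := by
    apply Subtype.ext
    change MvPowerSeries.map (starRingEnd ℂ) (r.1 * s.1) =
      MvPowerSeries.map (starRingEnd ℂ) s.1 * MvPowerSeries.map (starRingEnd ℂ) r.1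
    rw [map_mul, mul_comm]
  star_add r s := by
    apply Subtype.ext
    change MvPowerSeries.map (starRingEnd ℂ) (r.1 + s.1) =
      MvPowerSeries.map (starRingEnd ℂ) r.1 + MvPowerSeries.map (starRingEnd ℂ) s.1
    rw [map_add]

theorem coeff_star (r : N) (α : ℕ →₀ ℕ) :
    MvPowerSeries.coeff α (star r : N).1 = (starRingEnd ℂ) (MvPowerSeries.coeff α r.1) := by
  change MvPowerSeries.coeff α (MvPowerSeries.map (starRingEnd ℂ) r.1) = _
  rw [MvPowerSeries.coeff_map]

/-- Strict positivity of a square matrix over `𝔑`: it equals `G G*` with `G` invertible. -/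
def StrictlyPositive {n : ℕ} (M : Matrix (Fin n) (Fin n) N) : Prop :=
  ∃ G : Matrix (Fin n) (Fin n) N, IsUnit G ∧ M = G * G.conjTranspose

/-! ### Analytic functions with values in `𝔑` and Schur functions -/

/-- The open unit disk. -/
abbrev Disk : Type := Metric.ball (0 : ℂ) 1

/-- The series `∑ u_m` has its terms in `I(𝓗'_k)` and converges to `s` in the norm of that
space. -/
def HasSumIn (k : ℕ) (u : ℕ → N) (s : N) : Prop :=
  ∃ (v : ℕ → H k) (t : H k), (∀ m, (v m : MvPowerSeries ℕ ℂ) = (u m : MvPowerSeries ℕ ℂ)) ∧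
    (t : MvPowerSeries ℕ ℂ) = (s : MvPowerSeries ℕ ℂ) ∧ HasSum v t

/-- `∑ c_m (ζ - ζ₀)^m` is the Taylor expansion of `f` around `ζ₀`: for some `p` it converges to
`f ζ` in `I(𝓗'_p)`, for all `ζ` close to `ζ₀`. -/
def HasTaylorAt (f : Disk → N) (ζ₀ : Disk) (c : ℕ → N) : Prop :=
  ∃ p : ℕ, ∀ᶠ ζ : Disk in 𝓝 ζ₀,
    HasSumIn p (fun m => ((ζ : ℂ) - (ζ₀ : ℂ)) ^ m • c m) (f ζ)

/-- Analytic functions from the open unit disk to `𝔑`: near every point, the function is given by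
a power series which converges in one of the Hilbert spaces `I(𝓗'_p)`, where `p` may depend on
the point. Such a function is near every point a continuous function into some `I(𝓗'_p)`, so that
it is continuous into `𝔑 = ⋃_p I(𝓗'_p)` with the inductive limit topology. -/
def IsAnalytic (f : Disk → N) : Prop := ∀ ζ₀ : Disk, ∃ c : ℕ → N, HasTaylorAt f ζ₀ c

/-- The set `𝔑_𝔻` of the elements `r` of `𝔑` with `E(r)` in the open unit disk. -/
def NDisk : Set N := {r | E r ∈ Metric.ball (0 : ℂ) 1}

/-- `f(r) = s` for an analytic function `f` and `r ∈ 𝔑_𝔻`: if `∑ c_m (ζ - E(r))^m` is the Taylor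
expansion of `f` around `E(r)`, then `∑ c_m (r - E(r))^m` converges to `s` in some `I(𝓗'_q)`. -/
def HasValueAt (f : Disk → N) (r s : N) : Prop :=
  ∃ (h : E r ∈ Metric.ball (0 : ℂ) 1) (c : ℕ → N) (q : ℕ),
    HasTaylorAt f ⟨E r, h⟩ c ∧ HasSumIn q (fun m => c m * (r - algebraMap ℂ N (E r)) ^ m) s

/-- The Schur functions with values in `𝔑`: the analytic functions `f : 𝔻 → 𝔑` for which
`λ ↦ E(f(λ))`, which is then analytic, is bounded by `1` in modulus. -/
def schur : Set (Disk → N) := {f | IsAnalytic f ∧ ∀ z : Disk, ‖E (f z)‖ ≤ 1}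

/-! ### The matrix function `Θ` and its linear fractional transformation -/

variable {n : ℕ}

/-- The Pick matrix `P_{ij} = (1 - b_i b_j*) / (1 - a_i a_j*)`. -/
def pick (a b : Fin n → N) : Matrix (Fin n) (Fin n) N :=
  Matrix.of fun i j => (1 - b i * star (b j)) * (1 - a i * star (a j))⁻¹ʳ

/-- The matrix `A = diag(a_1*, …, a_n*)`. -/
def matA (a : Fin n → N) : Matrix (Fin n) (Fin n) N := Matrix.diagonal fun i => star (a i)

/-- The matrix `C` with rows `(1, …, 1)` and `(b_1*, …, b_n*)`. -/
def matC (b : Fin n → N) : Matrix (Fin 2) (Fin n) N :=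
  Matrix.of ![fun _ => 1, fun j => star (b j)]

/-- The signature matrix `J = diag(1, -1)`. -/
def matJ : Matrix (Fin 2) (Fin 2) N := !![1, 0; 0, -1]

/-- `Θ(λ) = I₂ - (1 - λ) C (I - λ A)⁻¹ P⁻¹ (I - A)^{-*} C* J`. -/
def theta (a b : Fin n → N) (z : ℂ) : Matrix (Fin 2) (Fin 2) N :=
  1 - (1 - z) • (matC b * (1 - z • matA a)⁻¹ * (pick a b)⁻¹ *
    ((1 - matA a).conjTranspose)⁻¹ * (matC b).conjTranspose * matJ)

/-- The denominator `c(λ) g(λ) + d(λ)` of the linear fractional transformation of `g`, where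
`c`, `d` form the second row of `Θ`. -/
def denom (a b : Fin n → N) (g : Disk → N) (z : Disk) : N :=
  theta a b z 1 0 * g z + theta a b z 1 1

/-- The linear fractional transformation `T_Θ(g) = (a g + b) / (c g + d)` of `g`, where `a`, `b`
and `c`, `d` are the rows of `Θ`. -/
def linFrac (a b : Fin n → N) (g : Disk → N) (z : Disk) : N :=
  (theta a b z 0 0 * g z + theta a b z 0 1) * (denom a b g z)⁻¹ʳ

end Kondratiev

end

/-!
The argument reduces all positivity to the constant coefficients `E(r)`, and treats the
interpolation conditions as divisibility in the commutative ring of analytic functions with values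
in `𝔑`.

*Invertibility.* The ring `𝔑` is the union of the Banach algebras `W m` of the power series with
`∑ |f_α| (2ℕ)^{-mα} < ∞`. An element with `E(s) = 0` becomes small in `W m` for large `m`, so that
the Neumann series shows that `r` is invertible if and only if `E(r) ≠ 0` (`isUnit_of_E_ne_zero`).
Analytic functions with values in `𝔑` are locally analytic functions with values in some `W m`
(`isAnalytic_iff`), which makes sums, products and pointwise inverses analytic.

*Point evaluation.* `f(r) = s` holds if and only if `f(λ) - s = (λ - r) g(λ)` with `g` analytic near
`E(r)` (`HasValueAt.exists_dvd`, `hasValueAt_of_dvd`): both sides are power series in `λ - E(r)`,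
and `r - E(r)` lies inside their disks of convergence in a large `W m`.

*Identities for `Θ`.* The Stein equation `P - A* P A = C* J C` gives
`C* J Θ(λ) = (λ - A*) P (I - A) (I - λ A)⁻¹ P⁻¹ (I - A)^{-*} C* J`, so that the entries of the row
`(1, -b_i) Θ` are divisible by `λ - a_i` (`exists_theta_dvd`), a determinant formula
`det Θ = κ ∏ (λ - a_i)` with `κ` invertible (`exists_theta_det`), and
`J - Θ J Θ* = (1 - |λ|²) C (I - λ A)⁻¹ P⁻¹ (I - λ A)^{-*} C*` (`theta_form`), whose constant
coefficient is positive semidefinite.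

*From `g` to `f`.* Contractivity of the constant coefficient of `Θ` makes `c g + d` invertible and
`f = T_Θ(g)` a Schur function, and `f(a_i) = b_i` follows from the divisibility of `(1, -b_i) Θ`.
The map is injective because `det Θ` is invertible away from finitely many points.

*From `f` to `g`.* If `f(a_i) = b_i`, then both entries of `(1, -f) Θ` are divisible by each
`λ - a_i`. As `P > 0` forces the numbers `E(a_i)` to be distinct, they are divisible by
`∏ (λ - a_i)`, say `(1, -f) Θ = ∏ (λ - a_i) (u, w)`. Pick's theorem for the scalar function `E ∘ f`
with the nodes `E(a_i)` and `λ` (`pick_schur_complement`), combined with the formula for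
`J - Θ J Θ*`, gives `|E(w)| ≤ |E(u)|`. The relation `(u, w) adj(Θ) = κ (1, -f)` shows that `E(u)`
and `E(w)` have no common zero. Hence `u` is invertible, and `g = -w / u` is the preimage of `f`.
-/

noncomputable section

namespace Kondratiev

/-! ### The weighted Wiener algebras -/

/-- The weighted Wiener algebra of the power series with `∑_α |f_α| (2ℕ)^{-mα} < ∞`. Because the
weights are multiplicative in `α`, this is a Banach algebra; `H k ⊆ wiener (k + 1)` and
`wiener m ⊆ H (2 m)`, so that the union over `m` of these algebras is `𝔑`. -/
def wiener (m : ℕ) : Subalgebra ℂ (MvPowerSeries ℕ ℂ) where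
  carrier := {f | Summable fun α => ‖MvPowerSeries.coeff α f‖ * (wt α ^ m)⁻¹}
  mul_mem' := by
    intro f g h1 h2
    have h3 := summable_sum_mul_antidiagonal_of_summable_mul
      (f := fun α => ‖MvPowerSeries.coeff α f‖ * (wt α ^ m)⁻¹)
      (g := fun α => ‖MvPowerSeries.coeff α g‖ * (wt α ^ m)⁻¹)
      (h1.mul_of_nonneg h2 (fun α => by have := wt_pos α; positivity)
        (fun α => by have := wt_pos α; positivity))
    refine Summable.of_nonneg_of_le (fun α => ?_) (fun α => ?_) h3
    · have := wt_pos α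
      positivity
    · have hw := wt_pos α
      rw [MvPowerSeries.coeff_mul]
      refine (mul_le_mul_of_nonneg_right (norm_sum_le _ _)
        (inv_nonneg.2 (pow_nonneg hw.le m))).trans (le_of_eq ?_)
      rw [Finset.sum_mul]
      refine Finset.sum_congr rfl fun p hp => ?_
      rw [← Finset.HasAntidiagonal.mem_antidiagonal.1 hp, wt_add, mul_pow, mul_inv, norm_mul]
      ring
  add_mem' := by
    intro f g hf hg
    refine Summable.of_nonneg_of_le (fun α => ?_) (fun α => ?_) (Summable.add hf hg)
    · have := wt_pos α
      positivity
    · have := wt_pos α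
      rw [map_add, ← add_mul]
      exact mul_le_mul_of_nonneg_right (norm_add_le _ _) (by positivity)
  algebraMap_mem' c := by
    refine summable_of_ne_finset_zero (s := {0}) fun α hα => ?_
    have hα' : α ≠ 0 := by simpa using hα
    rw [MvPowerSeries.algebraMap_apply, MvPowerSeries.coeff_C, if_neg hα']
    simp

theorem mem_wiener {m : ℕ} {f : MvPowerSeries ℕ ℂ} :
    f ∈ wiener m ↔ Summable fun α => ‖MvPowerSeries.coeff α f‖ * (wt α ^ m)⁻¹ := Iff.rfl

theorem tsum_norm_coeff_mul_le {m : ℕ} {f g : MvPowerSeries ℕ ℂ} (hf : f ∈ wiener m)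
    (hg : g ∈ wiener m) :
    ∑' α, ‖MvPowerSeries.coeff α (f * g)‖ * (wt α ^ m)⁻¹ ≤
      (∑' α, ‖MvPowerSeries.coeff α f‖ * (wt α ^ m)⁻¹) *
        ∑' α, ‖MvPowerSeries.coeff α g‖ * (wt α ^ m)⁻¹ := by
  have h0 : ∀ (f : MvPowerSeries ℕ ℂ) α, 0 ≤ ‖MvPowerSeries.coeff α f‖ * (wt α ^ m)⁻¹ :=
    fun f α => by
      have := wt_pos α
      positivity
  have hfg : Summable fun x : (ℕ →₀ ℕ) × (ℕ →₀ ℕ) =>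
      (‖MvPowerSeries.coeff x.1 f‖ * (wt x.1 ^ m)⁻¹) *
        (‖MvPowerSeries.coeff x.2 g‖ * (wt x.2 ^ m)⁻¹) :=
    Summable.mul_of_nonneg hf hg (h0 f) (h0 g)
  rw [Summable.tsum_mul_tsum_eq_tsum_sum_antidiagonal hf hg hfg]
  have h3 := summable_sum_mul_antidiagonal_of_summable_mul
    (f := fun α => ‖MvPowerSeries.coeff α f‖ * (wt α ^ m)⁻¹)
    (g := fun α => ‖MvPowerSeries.coeff α g‖ * (wt α ^ m)⁻¹) hfg
  refine Summable.tsum_le_tsum (fun α => ?_) (mem_wiener.1 ((wiener m).mul_mem hf hg)) h3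
  have hw := wt_pos α
  rw [MvPowerSeries.coeff_mul]
  refine (mul_le_mul_of_nonneg_right (norm_sum_le _ _)
    (inv_nonneg.2 (pow_nonneg hw.le m))).trans (le_of_eq ?_)
  rw [Finset.sum_mul]
  refine Finset.sum_congr rfl fun p hp => ?_
  rw [← Finset.HasAntidiagonal.mem_antidiagonal.1 hp, wt_add, mul_pow, mul_inv, norm_mul]
  ring

theorem wiener_mono {k l : ℕ} (h : k ≤ l) : wiener k ≤ wiener l := by
  intro f hf
  refine Summable.of_nonneg_of_le (fun α => ?_) (fun α => ?_) (mem_wiener.1 hf)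
  · have := wt_pos α
    positivity
  · have := wt_pos α
    have h1 := pow_le_pow_right₀ (one_le_wt α) h
    gcongr

/-- The weighted Wiener algebra as a type of its own, with the norm
`‖f‖ = ∑_α |f_α| (2ℕ)^{-mα}`. -/
def W (m : ℕ) : Type := wiener m

namespace W

/-- The weighted coefficients `f_α (2ℕ)^{-mα}`, as an element of `ℓ¹`. -/
def toL1 (m : ℕ) : wiener m →ₗ[ℂ] lp (fun _ : ℕ →₀ ℕ => ℂ) 1 where
  toFun f := ⟨fun α => (((wt α ^ m)⁻¹ : ℝ) : ℂ) * MvPowerSeries.coeff α f.1, by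
    refine memℓp_gen ?_
    refine (mem_wiener.1 f.2).congr fun α => ?_
    have hw : 0 ≤ (wt α ^ m)⁻¹ := inv_nonneg.2 (pow_nonneg (wt_pos α).le m)
    rw [norm_mul, Complex.norm_real, Real.norm_of_nonneg hw]
    simp [mul_comm]⟩
  map_add' f g := by
    ext α
    simp only [Subalgebra.coe_add, map_add, mul_add]
    rfl
  map_smul' c f := by
    ext α
    simp only [Subalgebra.coe_smul, RingHom.id_apply, lp.coeFn_smul, Pi.smul_apply, smul_eq_mul]
    rw [MvPowerSeries.coeff_smul]
    ring

theorem toL1_apply (m : ℕ) (f : wiener m) (α : ℕ →₀ ℕ) :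
    toL1 m f α = (((wt α ^ m)⁻¹ : ℝ) : ℂ) * MvPowerSeries.coeff α f.1 := rfl

theorem toL1_injective (m : ℕ) : Function.Injective (toL1 m) := by
  intro f g h
  apply Subtype.ext
  ext α
  have h1 := congrArg (fun u : lp (fun _ : ℕ →₀ ℕ => ℂ) 1 => u α) h
  simp only [toL1_apply] at h1
  refine mul_left_cancel₀ ?_ h1
  have : 0 < (wt α ^ m)⁻¹ := inv_pos.2 (pow_pos (wt_pos α) m)
  exact_mod_cast this.ne'

theorem toL1_surjective (m : ℕ) : Function.Surjective (toL1 m) := by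
  intro u
  have hu : Summable fun α => ‖u α‖ := by simpa using (lp.memℓp u).summable (by simp)
  let f : MvPowerSeries ℕ ℂ := fun α => ((wt α ^ m : ℝ) : ℂ) * u α
  have hf : ∀ α, MvPowerSeries.coeff α f = ((wt α ^ m : ℝ) : ℂ) * u α := fun α => rfl
  have hw : ∀ α, 0 < wt α ^ m := fun α => pow_pos (wt_pos α) m
  refine ⟨⟨f, mem_wiener.2 (hu.congr fun α => ?_)⟩, ?_⟩
  · rw [hf, norm_mul, Complex.norm_real, Real.norm_of_nonneg (hw α).le]
    field_simp [(hw α).ne']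
  · ext α
    rw [toL1_apply]
    change _ * MvPowerSeries.coeff α f = _
    rw [hf, ← mul_assoc, ← Complex.ofReal_mul, inv_mul_cancel₀ (hw α).ne']
    simp

theorem norm_toL1 (m : ℕ) (f : wiener m) :
    ‖toL1 m f‖ = ∑' α, ‖MvPowerSeries.coeff α f.1‖ * (wt α ^ m)⁻¹ := by
  rw [lp.norm_eq_tsum_rpow (by simp)]
  simp only [ENNReal.toReal_one, Real.rpow_one, one_div, inv_one]
  refine tsum_congr fun α => ?_
  have hw : 0 ≤ (wt α ^ m)⁻¹ := inv_nonneg.2 (pow_nonneg (wt_pos α).le m)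
  rw [toL1_apply, norm_mul, Complex.norm_real, Real.norm_of_nonneg hw, mul_comm]

instance (m : ℕ) : NormedCommRing (W m) :=
  { NormedAddCommGroup.induced (wiener m) (lp (fun _ : ℕ →₀ ℕ => ℂ) 1) (toL1 m)
      (toL1_injective m), (inferInstance : CommRing (wiener m)) with
    norm_mul_le := fun (f g : wiener m) => by
      change ‖toL1 m (f * g)‖ ≤ ‖toL1 m f‖ * ‖toL1 m g‖
      rw [norm_toL1, norm_toL1, norm_toL1]
      exact tsum_norm_coeff_mul_le f.2 g.2 }

instance (m : ℕ) : NormedAlgebra ℂ (W m) :=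
  { (inferInstance : Algebra ℂ (wiener m)) with
    norm_smul_le := fun c (f : wiener m) => by
      change ‖toL1 m (c • f)‖ ≤ ‖c‖ * ‖toL1 m f‖
      rw [map_smul, norm_smul] }

instance (m : ℕ) : CompleteSpace (W m) := by
  let φ : W m → lp (fun _ : ℕ →₀ ℕ => ℂ) 1 := toL1 m
  have h : Isometry φ := Isometry.of_dist_eq fun f g => by
    rw [dist_eq_norm, dist_eq_norm]
    exact congrArg norm (map_sub (toL1 m) f g).symm
  exact (completeSpace_iff_isComplete_range h.isUniformInducing).2
    ((toL1_surjective m).range_eq ▸ isComplete_univ)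

/-- The power series underlying an element of a weighted Wiener algebra. -/
def val (m : ℕ) : W m →ₐ[ℂ] MvPowerSeries ℕ ℂ := (wiener m).val

/-- A power series which belongs to a weighted Wiener algebra, as an element of it. -/
def mk {m : ℕ} (f : MvPowerSeries ℕ ℂ) (hf : f ∈ wiener m) : W m := Subtype.mk f hf

theorem val_mk {m : ℕ} (f : MvPowerSeries ℕ ℂ) (hf : f ∈ wiener m) : val m (mk f hf) = f := rfl

theorem val_mem {m : ℕ} (f : W m) : val m f ∈ wiener m := Subtype.prop f

theorem val_injective (m : ℕ) : Function.Injective (val m) := Subtype.val_injective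

theorem norm_eq {m : ℕ} (f : W m) :
    ‖f‖ = ∑' α, ‖MvPowerSeries.coeff α (val m f)‖ * (wt α ^ m)⁻¹ := norm_toL1 m f

theorem norm_coeff_mul_le {m : ℕ} (f : W m) (α : ℕ →₀ ℕ) :
    ‖MvPowerSeries.coeff α (val m f)‖ * (wt α ^ m)⁻¹ ≤ ‖f‖ := by
  rw [norm_eq]
  exact (mem_wiener.1 (val_mem f)).le_tsum α fun β _ => by have := wt_pos β; positivity

/-- The coefficient functionals are continuous on the weighted Wiener algebras. -/
def coeff (m : ℕ) (α : ℕ →₀ ℕ) : W m →L[ℂ] ℂ :=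
  LinearMap.mkContinuous ((MvPowerSeries.coeff α).comp (val m).toLinearMap) (wt α ^ m)
    fun f => by
      have h := norm_coeff_mul_le f α
      rwa [mul_inv_le_iff₀ (pow_pos (wt_pos α) m), mul_comm] at h

theorem coeff_apply (m : ℕ) (α : ℕ →₀ ℕ) (f : W m) :
    coeff m α f = MvPowerSeries.coeff α (val m f) := rfl

/-- The inclusion of a weighted Wiener algebra into a larger one. -/
def incl {k l : ℕ} (h : k ≤ l) : W k →ₐ[ℂ] W l :=
  (val k).codRestrict (wiener l) fun f => wiener_mono h (val_mem f)

theorem val_incl {k l : ℕ} (h : k ≤ l) (f : W k) : val l (incl h f) = val k f :=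
  AlgHom.coe_codRestrict (val k) (wiener l) (fun f => wiener_mono h (val_mem f)) f

theorem norm_incl_le {k l : ℕ} (h : k ≤ l) (f : W k) : ‖incl h f‖ ≤ ‖f‖ := by
  rw [norm_eq, norm_eq]
  refine Summable.tsum_le_tsum (fun α => ?_) (mem_wiener.1 (val_mem _))
    (mem_wiener.1 (val_mem f))
  have := wt_pos α
  have h1 := pow_le_pow_right₀ (one_le_wt α) h
  rw [val_incl]
  gcongr

/-- The inclusion of a weighted Wiener algebra into a larger one, as a continuous linear map. -/
def inclL {k l : ℕ} (h : k ≤ l) : W k →L[ℂ] W l :=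
  LinearMap.mkContinuous (incl h).toLinearMap 1 fun f => by
    rw [one_mul]
    exact norm_incl_le h f

theorem inclL_apply {k l : ℕ} (h : k ≤ l) (f : W k) : inclL h f = incl h f := by
  rw [inclL, LinearMap.mkContinuous_apply, AlgHom.toLinearMap_apply]

instance (m : ℕ) : NormOneClass (W m) where
  norm_one := by
    rw [norm_eq, tsum_eq_single 0, map_one]
    · simp [wt_zero, MvPowerSeries.coeff_zero_eq_constantCoeff_apply]
    · intro α hα
      rw [map_one, MvPowerSeries.coeff_one, if_neg hα, norm_zero, zero_mul]

theorem wiener_le_hermiteImage (m : ℕ) : wiener m ≤ hermiteImage :=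
  fun _ hf => ⟨2 * m, mem_of_summable_norm hf⟩

/-- The inclusion of a weighted Wiener algebra into `𝔑`. -/
def toN (m : ℕ) : W m →ₐ[ℂ] N :=
  (val m).codRestrict hermiteImage fun f => wiener_le_hermiteImage m (val_mem f)

theorem coe_toN (m : ℕ) (f : W m) : (toN m f : MvPowerSeries ℕ ℂ) = val m f :=
  AlgHom.coe_codRestrict (val m) hermiteImage
    (fun f => wiener_le_hermiteImage m (val_mem f)) f

theorem toN_injective (m : ℕ) : Function.Injective (toN m) := fun _ _ h =>
  val_injective m (by rw [← coe_toN, ← coe_toN, h])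

theorem toN_incl {k l : ℕ} (h : k ≤ l) (f : W k) : toN l (incl h f) = toN k f :=
  Subtype.ext (by rw [coe_toN, coe_toN, val_incl])

end W

open W

theorem exists_toN_eq (r : N) : ∃ m, ∀ l, m ≤ l → ∃ f : W l, toN l f = r := by
  obtain ⟨k, hk⟩ := r.2
  exact ⟨k + 1, fun l hl => ⟨W.mk r.1 (mem_wiener.2 (summable_norm_of_mem hk hl)),
    Subtype.ext (by rw [coe_toN, val_mk])⟩⟩

theorem two_le_wt {α : ℕ →₀ ℕ} (h : α ≠ 0) : 2 ≤ wt α := by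
  obtain ⟨j, hj⟩ := Finsupp.ne_iff.1 h
  have h1 : Finsupp.single j 1 + (α - Finsupp.single j 1) = α := by
    refine add_tsub_cancel_of_le (Finsupp.single_le_iff.2 (Nat.one_le_iff_ne_zero.2 ?_))
    simpa using hj
  rw [← h1, wt_add]
  have h2 : wt (Finsupp.single j 1) = 2 * ((j : ℝ) + 1) := by simp [wt]
  have h3 : (0 : ℝ) ≤ j := Nat.cast_nonneg j
  have h4 := one_le_wt (α - Finsupp.single j 1)
  rw [h2]
  nlinarith

/-- Elements of the augmentation ideal become small in the large Wiener algebras, since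
`(2ℕ)^α ≥ 2` for `α ≠ 0`. -/
theorem exists_norm_lt {s : N} (hs : E s = 0) {ε : ℝ} (hε : 0 < ε) :
    ∃ m, ∀ l, m ≤ l → ∃ f : W l, toN l f = s ∧ ‖f‖ < ε := by
  obtain ⟨k, hk⟩ := exists_toN_eq s
  obtain ⟨f, hf⟩ := hk k le_rfl
  have hf0 : MvPowerSeries.coeff 0 (val k f) = 0 := by
    rw [MvPowerSeries.coeff_zero_eq_constantCoeff_apply]
    rw [← hf] at hs
    exact hs
  obtain ⟨j, hj⟩ := exists_pow_lt_of_lt_one (div_pos hε (by positivity : 0 < ‖f‖ + 1))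
    (by norm_num : (1 / 2 : ℝ) < 1)
  refine ⟨k + j, fun l hl => ⟨incl (by omega) f, (toN_incl _ f).trans hf, ?_⟩⟩
  have h1 : ‖incl (by omega : k ≤ l) f‖ ≤ ‖incl (by omega : k ≤ k + j) f‖ := by
    have h := norm_incl_le hl (incl (by omega : k ≤ k + j) f)
    rwa [show incl hl (incl (by omega : k ≤ k + j) f) = incl (by omega) f from
      toN_injective _ (by simp only [toN_incl])] at h
  refine h1.trans_lt ?_
  have h2 : ‖incl (by omega : k ≤ k + j) f‖ ≤ (1 / 2) ^ j * ‖f‖ := by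
    rw [norm_eq, norm_eq, ← tsum_mul_left]
    refine Summable.tsum_le_tsum (fun α => ?_) (mem_wiener.1 (val_mem _))
      ((mem_wiener.1 (val_mem f)).mul_left _)
    rw [val_incl]
    by_cases hα : α = 0
    · rw [hα, hf0]
      simp
    · have hw := wt_pos α
      have h3 : (wt α ^ j)⁻¹ ≤ (1 / 2) ^ j := by
        rw [← inv_pow, one_div]
        exact pow_le_pow_left₀ (by positivity) (inv_anti₀ two_pos (two_le_wt hα)) j
      calc ‖MvPowerSeries.coeff α (val k f)‖ * (wt α ^ (k + j))⁻¹
          = (wt α ^ j)⁻¹ * (‖MvPowerSeries.coeff α (val k f)‖ * (wt α ^ k)⁻¹) := by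
            rw [pow_add, mul_inv]; ring
        _ ≤ _ := mul_le_mul_of_nonneg_right h3 (by positivity)
  refine h2.trans_lt ?_
  rw [lt_div_iff₀ (by positivity)] at hj
  have : (0 : ℝ) < (1 / 2) ^ j := by positivity
  nlinarith

theorem E_algebraMap (c : ℂ) : E (algebraMap ℂ N c) = c := by
  change MvPowerSeries.constantCoeff (algebraMap ℂ (MvPowerSeries ℕ ℂ) c) = c
  simp [MvPowerSeries.algebraMap_apply]

theorem E_star (r : N) : E (star r) = star (E r) := by
  have h := coeff_star r 0
  simp only [MvPowerSeries.coeff_zero_eq_constantCoeff_apply] at h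
  exact h

/-- An element of `𝔑` is invertible as soon as its constant coefficient does not vanish: up to a
scalar it is `1 - s` with `E s = 0`, and the Neumann series converges in a large Wiener algebra. -/
theorem isUnit_of_E_ne_zero {r : N} (h : E r ≠ 0) : IsUnit r := by
  have hs : E (1 - algebraMap ℂ N (E r)⁻¹ * r) = 0 := by
    rw [map_sub, map_mul, E_algebraMap, map_one, inv_mul_cancel₀ h, sub_self]
  obtain ⟨m, hm⟩ := exists_norm_lt hs one_pos
  obtain ⟨f, hf, hf1⟩ := hm m le_rfl
  have h1 := (isUnit_one_sub_of_norm_lt_one hf1).map (toN m)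
  rw [map_sub, map_one, hf, sub_sub_cancel] at h1
  exact isUnit_of_mul_isUnit_right h1

theorem isUnit_iff_E_ne_zero {r : N} : IsUnit r ↔ E r ≠ 0 :=
  ⟨fun h => (h.map E).ne_zero, isUnit_of_E_ne_zero⟩

theorem exists_isUnit_incl {m : ℕ} (f : W m) (h : E (toN m f) ≠ 0) :
    ∃ l, ∃ hl : m ≤ l, IsUnit (incl hl f) := by
  obtain ⟨u, hu⟩ := isUnit_of_E_ne_zero h
  obtain ⟨k, hk⟩ := exists_toN_eq (↑u⁻¹ : N)
  obtain ⟨g, hg⟩ := hk (max m k) (le_max_right _ _)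
  refine ⟨max m k, le_max_left _ _, IsUnit.of_mul_eq_one g (toN_injective _ ?_)⟩
  rw [map_mul, map_one, hg, toN_incl, ← hu, Units.mul_inv]

/-! ### The Wiener algebras and the Hilbert spaces -/

/-- The inclusion of a Hilbert space `I(𝓗'_k)` into a weighted Wiener algebra, which is continuous
by the Cauchy–Schwarz inequality and `∑_α (2ℕ)^{-(k+2)α} < ∞`. -/
def toW (k : ℕ) : H k →L[ℂ] W (k + 1) :=
  LinearMap.mkContinuousOfExistsBound
    { toFun := fun f => W.mk f.1 (mem_wiener.2 (summable_norm_of_mem f.2 le_rfl))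
      map_add' := fun f g => val_injective _ <| by
        rw [map_add, val_mk, val_mk, val_mk, Submodule.coe_add]
      map_smul' := fun c f => val_injective _ <| by
        rw [RingHom.id_apply, map_smul, val_mk, val_mk, Submodule.coe_smul] } <| by
    refine ⟨(∑' α, (wt α ^ (k + 2))⁻¹) ^ (1 / 2 : ℝ), fun f => ?_⟩
    have hs : Summable fun α : ℕ →₀ ℕ => (wt α ^ (k + 2))⁻¹ :=
      Summable.of_nonneg_of_le (fun α => by have := wt_pos α; positivity)
        (fun α => inv_anti₀ (pow_pos (wt_pos α) 2)
          (pow_le_pow_right₀ (one_le_wt α) (by omega))) summable_wt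
    have hsq : ∀ α, √((wt α ^ k)⁻¹) ^ 2 = (wt α ^ k)⁻¹ := fun α =>
      Real.sq_sqrt (inv_nonneg.2 (pow_nonneg (wt_pos α).le k))
    have hsq' : ∀ α, √((wt α ^ (k + 2))⁻¹) ^ 2 = (wt α ^ (k + 2))⁻¹ := fun α =>
      Real.sq_sqrt (inv_nonneg.2 (pow_nonneg (wt_pos α).le (k + 2)))
    have h1 : ∀ α, ‖MvPowerSeries.coeff α f.1‖ * (wt α ^ (k + 1))⁻¹ =
        (‖MvPowerSeries.coeff α f.1‖ * √((wt α ^ k)⁻¹)) * √((wt α ^ (k + 2))⁻¹) := fun α => by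
      have hw := wt_pos α
      rw [mul_assoc, ← Real.sqrt_mul (by positivity), ← mul_inv, ← pow_add,
        show k + (k + 2) = (k + 1) * 2 by ring, pow_mul,
          ← inv_pow ((wt α) ^ (k + 1)), Real.sqrt_sq (by positivity)]
    have h2 := Real.inner_le_Lp_mul_Lq_tsum_of_nonneg Real.HolderConjugate.two_two
      (f := fun α => ‖MvPowerSeries.coeff α f.1‖ * √((wt α ^ k)⁻¹))
      (g := fun α => √((wt α ^ (k + 2))⁻¹))
      (fun α => by positivity) (fun α => by positivity)
      ((mem_H.1 f.2).congr fun α => by rw [Real.rpow_two, mul_pow, hsq])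
      (hs.congr fun α => by rw [Real.rpow_two, hsq'])
    have h3 : (∑' α, (‖MvPowerSeries.coeff α f.1‖ * √((wt α ^ k)⁻¹)) ^ (2 : ℝ)) = ‖f‖ ^ 2 := by
      rw [norm_sq_eq]
      exact tsum_congr fun α => by rw [Real.rpow_two, mul_pow, hsq]
    have h4 : ∀ α, √((wt α ^ (k + 2))⁻¹) ^ (2 : ℝ) = (wt α ^ (k + 2))⁻¹ := fun α => by
      rw [Real.rpow_two, hsq']
    have h5 := h2
    rw [h3, ← Real.sqrt_eq_rpow, Real.sqrt_sq (norm_nonneg f), tsum_congr h4] at h5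
    change ‖W.mk f.1 _‖ ≤ _
    rw [W.norm_eq, val_mk, tsum_congr h1, mul_comm]
    exact h5

theorem val_toW (k : ℕ) (f : H k) : val (k + 1) (toW k f) = f.1 := by
  have h : toW k f = W.mk f.1 (mem_wiener.2 (summable_norm_of_mem f.2 le_rfl)) := rfl
  rw [h, val_mk]

/-- The inclusion of a weighted Wiener algebra into a Hilbert space `I(𝓗'_k)`. -/
def toH (m : ℕ) : W m →L[ℂ] H (2 * m) :=
  LinearMap.mkContinuous
    { toFun := fun f => ⟨val m f, mem_of_summable_norm (mem_wiener.1 (val_mem f))⟩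
      map_add' := fun f g => Subtype.ext (map_add (val m) f g)
      map_smul' := fun c f => Subtype.ext (map_smul (val m) c f) } 1 fun f => by
    rw [one_mul]
    refine abs_le_of_sq_le_sq' ?_ (norm_nonneg f) |>.2
    have h0 : ∀ α, 0 ≤ ‖MvPowerSeries.coeff α (val m f)‖ * (wt α ^ m)⁻¹ := fun α => by
      have := wt_pos α
      positivity
    have hs := mem_wiener.1 (val_mem f)
    rw [norm_sq_eq]
    change (∑' α, ‖MvPowerSeries.coeff α (val m f)‖ ^ 2 * (wt α ^ (2 * m))⁻¹) ≤ _
    calc (∑' α, ‖MvPowerSeries.coeff α (val m f)‖ ^ 2 * (wt α ^ (2 * m))⁻¹)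
        ≤ ∑' α, ‖f‖ * (‖MvPowerSeries.coeff α (val m f)‖ * (wt α ^ m)⁻¹) := by
          refine Summable.tsum_le_tsum (fun α => ?_) (mem_H.1 (mem_of_summable_norm hs))
            (hs.mul_left _)
          have h1 : ‖MvPowerSeries.coeff α (val m f)‖ ^ 2 * (wt α ^ (2 * m))⁻¹ =
              (‖MvPowerSeries.coeff α (val m f)‖ * (wt α ^ m)⁻¹) *
                (‖MvPowerSeries.coeff α (val m f)‖ * (wt α ^ m)⁻¹) := by
            rw [two_mul, pow_add, mul_inv]
            ring
          rw [h1]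
          exact mul_le_mul_of_nonneg_right (norm_coeff_mul_le f α) (h0 α)
      _ = ‖f‖ ^ 2 := by rw [tsum_mul_left, ← W.norm_eq, sq]

theorem coe_toH (m : ℕ) (f : W m) : (toH m f).1 = val m f := rfl

theorem hasSumIn_of_hasSum {m : ℕ} {u : ℕ → W m} {t : W m} (h : HasSum u t) :
    HasSumIn (2 * m) (fun j => toN m (u j)) (toN m t) :=
  ⟨fun j => toH m (u j), toH m t, fun j => by rw [coe_toH, coe_toN], by rw [coe_toH, coe_toN],
    h.mapL (toH m)⟩

theorem HasSumIn.exists_hasSum {k : ℕ} {u : ℕ → N} {s : N} (h : HasSumIn k u s) :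
    ∃ (v : ℕ → W (k + 1)) (t : W (k + 1)),
      (∀ j, toN (k + 1) (v j) = u j) ∧ toN (k + 1) t = s ∧ HasSum v t := by
  obtain ⟨v, t, hv, ht, hs⟩ := h
  exact ⟨fun j => toW k (v j), toW k t,
    fun j => Subtype.ext (by rw [coe_toN, val_toW, hv]),
    Subtype.ext (by rw [coe_toN, val_toW, ht]), hs.mapL (toW k)⟩

theorem HasSumIn.hasSum_coeff {k : ℕ} {u : ℕ → N} {s : N} (h : HasSumIn k u s) (α : ℕ →₀ ℕ) :
    HasSum (fun j => MvPowerSeries.coeff α (u j : MvPowerSeries ℕ ℂ))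
      (MvPowerSeries.coeff α (s : MvPowerSeries ℕ ℂ)) := by
  obtain ⟨v, t, hv, ht, hs⟩ := h.exists_hasSum
  have h1 := hs.mapL (W.coeff (k + 1) α)
  simp only [coeff_apply, ← coe_toN, hv, ht] at h1
  exact h1

theorem HasSumIn.unique {k l : ℕ} {u : ℕ → N} {s t : N} (h : HasSumIn k u s)
    (h' : HasSumIn l u t) : s = t := by
  apply Subtype.ext
  ext α
  exact (h.hasSum_coeff α).unique (h'.hasSum_coeff α)

/-! ### Analytic germs -/

theorem eventually_disk_iff {p : ℂ → Prop} {ζ₀ : Disk} :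
    (∀ᶠ ζ : Disk in 𝓝 ζ₀, p ζ) ↔ ∀ᶠ z in 𝓝 (ζ₀ : ℂ), p z := by
  rw [← Metric.isOpen_ball.isOpenEmbedding_subtypeVal.map_nhds_eq ζ₀, Filter.eventually_map]

theorem eventually_nhds_iff_add {p : ℂ → Prop} {z₀ : ℂ} :
    (∀ᶠ z in 𝓝 z₀, p z) ↔ ∀ᶠ x in 𝓝 (0 : ℂ), p (z₀ + x) := by
  rw [← Filter.eventually_map (m := fun x => z₀ + x), map_add_left_nhds, add_zero]

/-- Analyticity of `f` at a single point: near this point, `f` is an analytic function in the usual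
sense with values in one of the Banach algebras `W m`. -/
def AnAt (f : Disk → N) (ζ₀ : Disk) : Prop :=
  ∃ (m : ℕ) (F : ℂ → W m), AnalyticAt ℂ F ζ₀ ∧ ∀ᶠ ζ : Disk in 𝓝 ζ₀, f ζ = toN m (F ζ)

/-- The formal power series with prescribed coefficients. -/
def seriesOf {m : ℕ} (c : ℕ → W m) : FormalMultilinearSeries ℂ ℂ (W m) :=
  fun j => ContinuousMultilinearMap.mkPiRing ℂ (Fin j) (c j)

theorem coeff_seriesOf {m : ℕ} (c : ℕ → W m) (j : ℕ) : (seriesOf c).coeff j = c j := by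
  simp [seriesOf, FormalMultilinearSeries.coeff]

theorem analyticAt_of_hasSum {m : ℕ} {c : ℕ → W m} {F : ℂ → W m} {z₀ : ℂ}
    (h : ∀ᶠ x in 𝓝 (0 : ℂ), HasSum (fun j => x ^ j • c j) (F (z₀ + x))) : AnalyticAt ℂ F z₀ :=
  ⟨seriesOf c, hasFPowerSeriesAt_iff.2 <| by simpa only [coeff_seriesOf] using h⟩

theorem AnalyticAt.exists_hasSum {m : ℕ} {F : ℂ → W m} {z₀ : ℂ} (h : AnalyticAt ℂ F z₀) :
    ∃ c : ℕ → W m, ∀ᶠ x in 𝓝 (0 : ℂ), HasSum (fun j => x ^ j • c j) (F (z₀ + x)) := by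
  obtain ⟨p, hp⟩ := h
  exact ⟨p.coeff, hasFPowerSeriesAt_iff.1 hp⟩

/-- A Taylor expansion in the sense of `HasTaylorAt` is the Taylor expansion of a function with
values in some `W m`. -/
theorem HasTaylorAt.exists_wiener {f : Disk → N} {ζ₀ : Disk} {c : ℕ → N}
    (h : HasTaylorAt f ζ₀ c) : ∃ (m : ℕ) (d : ℕ → W m) (F : ℂ → W m), (∀ j, toN m (d j) = c j) ∧
      (∀ᶠ x in 𝓝 (0 : ℂ), HasSum (fun j => x ^ j • d j) (F (ζ₀ + x))) ∧
      ∀ᶠ ζ : Disk in 𝓝 ζ₀, f ζ = toN m (F ζ) := by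
  obtain ⟨p, hp⟩ := h
  have hp' : ∀ᶠ z in 𝓝 (ζ₀ : ℂ), ∃ hz : z ∈ Metric.ball (0 : ℂ) 1,
      HasSumIn p (fun j => (z - (ζ₀ : ℂ)) ^ j • c j) (f ⟨z, hz⟩) :=
    eventually_disk_iff.1 (hp.mono fun ζ hζ => ⟨ζ.2, hζ⟩)
  -- A point different from `ζ₀` shows that all the coefficients lie in `H p`.
  obtain ⟨z₁, ⟨hz₁, h₁⟩, hne⟩ :=
    ((hp'.filter_mono nhdsWithin_le_nhds).and (self_mem_nhdsWithin (s := {(ζ₀ : ℂ)}ᶜ))).exists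
  have hne' : z₁ - (ζ₀ : ℂ) ≠ 0 := sub_ne_zero.2 hne
  obtain ⟨v₁, t₁, hv₁, -, -⟩ := h₁.exists_hasSum
  let d : ℕ → W (p + 1) := fun j => ((z₁ - (ζ₀ : ℂ)) ^ j)⁻¹ • v₁ j
  have hd : ∀ j, toN (p + 1) (d j) = c j := fun j => by
    rw [map_smul, hv₁, smul_smul, inv_mul_cancel₀ (pow_ne_zero j hne'), one_smul]
  have hsum : ∀ z (hz : z ∈ Metric.ball (0 : ℂ) 1),
      HasSumIn p (fun j => (z - (ζ₀ : ℂ)) ^ j • c j) (f ⟨z, hz⟩) →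
      ∃ t, toN (p + 1) t = f ⟨z, hz⟩ ∧ HasSum (fun j => (z - (ζ₀ : ℂ)) ^ j • d j) t := by
    intro z hz hs
    obtain ⟨v, t, hv, ht, hvt⟩ := hs.exists_hasSum
    refine ⟨t, ht, ?_⟩
    have hvd : (fun j => (z - (ζ₀ : ℂ)) ^ j • d j) = v := by
      ext1 j
      refine toN_injective _ ?_
      rw [map_smul, hd, hv]
    rwa [hvd]
  refine ⟨p + 1, d, fun z => ∑' j, (z - (ζ₀ : ℂ)) ^ j • d j, hd, ?_, ?_⟩
  · refine (eventually_nhds_iff_add.1 hp').mono fun x hx => ?_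
    obtain ⟨hz, hs⟩ := hx
    obtain ⟨t, -, ht⟩ := hsum _ hz hs
    simpa only [add_sub_cancel_left] using ht.summable.hasSum
  · refine hp.mono fun ζ hζ => ?_
    obtain ⟨t, ht, hs⟩ := hsum ζ ζ.2 hζ
    beta_reduce
    rw [hs.tsum_eq, ht]

theorem HasTaylorAt.anAt {f : Disk → N} {ζ₀ : Disk} {c : ℕ → N} (h : HasTaylorAt f ζ₀ c) :
    AnAt f ζ₀ := by
  obtain ⟨m, d, F, -, hF, hf⟩ := h.exists_wiener
  exact ⟨m, F, analyticAt_of_hasSum hF, hf⟩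

theorem hasTaylorAt_of_hasSum {f : Disk → N} {ζ₀ : Disk} {m : ℕ} {d : ℕ → W m} {F : ℂ → W m}
    (hd : ∀ᶠ x in 𝓝 (0 : ℂ), HasSum (fun j => x ^ j • d j) (F (ζ₀ + x)))
    (hf : ∀ᶠ ζ : Disk in 𝓝 ζ₀, f ζ = toN m (F ζ)) :
    HasTaylorAt f ζ₀ fun j => toN m (d j) := by
  refine ⟨2 * m, ?_⟩
  have hd' : ∀ᶠ z in 𝓝 (ζ₀ : ℂ), HasSum (fun j => (z - (ζ₀ : ℂ)) ^ j • d j) (F z) := by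
    rw [eventually_nhds_iff_add]
    simpa only [add_sub_cancel_left] using hd
  filter_upwards [hf, eventually_disk_iff.2 hd'] with ζ h1 h2
  rw [h1]
  have h3 := hasSumIn_of_hasSum h2
  simpa only [map_smul] using h3

theorem isAnalytic_iff {f : Disk → N} : IsAnalytic f ↔ ∀ ζ₀, AnAt f ζ₀ := by
  refine ⟨fun h ζ₀ => (h ζ₀).choose_spec.anAt, fun h ζ₀ => ?_⟩
  obtain ⟨m, F, hF, hf⟩ := h ζ₀
  obtain ⟨d, hd⟩ := AnalyticAt.exists_hasSum hF
  exact ⟨_, hasTaylorAt_of_hasSum hd hf⟩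

namespace AnAt

variable {f g : Disk → N} {ζ₀ : Disk}

theorem congr (h : AnAt f ζ₀) (hfg : ∀ᶠ ζ in 𝓝 ζ₀, f ζ = g ζ) : AnAt g ζ₀ := by
  obtain ⟨m, F, hF, hf⟩ := h
  exact ⟨m, F, hF, (hf.and hfg).mono fun ζ hζ => hζ.2.symm.trans hζ.1⟩

/-- The values of an analytic germ may be taken in any sufficiently large `W m`. -/
theorem exists_of_le (h : AnAt f ζ₀) : ∃ m, ∀ l, m ≤ l → ∃ F : ℂ → W l,
    AnalyticAt ℂ F ζ₀ ∧ ∀ᶠ ζ : Disk in 𝓝 ζ₀, f ζ = toN l (F ζ) := by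
  obtain ⟨m, F, hF, hf⟩ := h
  refine ⟨m, fun l hl => ⟨fun z => inclL hl (F z), ((inclL hl).analyticAt _).comp hF,
    hf.mono fun ζ hζ => ?_⟩⟩
  beta_reduce
  rw [hζ, inclL_apply, toN_incl]

theorem exists_common (hf : AnAt f ζ₀) (hg : AnAt g ζ₀) : ∃ (m : ℕ) (F G : ℂ → W m),
    AnalyticAt ℂ F ζ₀ ∧ AnalyticAt ℂ G ζ₀ ∧ (∀ᶠ ζ : Disk in 𝓝 ζ₀, f ζ = toN m (F ζ)) ∧
      ∀ᶠ ζ : Disk in 𝓝 ζ₀, g ζ = toN m (G ζ) := by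
  obtain ⟨k, hk⟩ := hf.exists_of_le
  obtain ⟨l, hl⟩ := hg.exists_of_le
  obtain ⟨F, hF, hF'⟩ := hk (max k l) (le_max_left _ _)
  obtain ⟨G, hG, hG'⟩ := hl (max k l) (le_max_right _ _)
  exact ⟨_, F, G, hF, hG, hF', hG'⟩

theorem const (r : N) : AnAt (fun _ => r) ζ₀ := by
  obtain ⟨m, hm⟩ := exists_toN_eq r
  obtain ⟨t, ht⟩ := hm m le_rfl
  exact ⟨m, fun _ => t, analyticAt_const, Filter.Eventually.of_forall fun _ => ht.symm⟩

/-- The coordinate function of the disk is analytic. -/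
theorem coord : AnAt (fun ζ => algebraMap ℂ N ζ) ζ₀ := by
  refine ⟨0, fun z => z • 1, analyticAt_id.smul analyticAt_const,
    Filter.Eventually.of_forall fun ζ => ?_⟩
  beta_reduce
  rw [map_smul, map_one, Algebra.algebraMap_eq_smul_one]

theorem add (hf : AnAt f ζ₀) (hg : AnAt g ζ₀) : AnAt (fun ζ => f ζ + g ζ) ζ₀ := by
  obtain ⟨m, F, G, hF, hG, hF', hG'⟩ := hf.exists_common hg
  exact ⟨m, fun z => F z + G z, hF.add hG, (hF'.and hG').mono fun ζ h => by
    beta_reduce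
    rw [h.1, h.2, map_add]⟩

theorem mul (hf : AnAt f ζ₀) (hg : AnAt g ζ₀) : AnAt (fun ζ => f ζ * g ζ) ζ₀ := by
  obtain ⟨m, F, G, hF, hG, hF', hG'⟩ := hf.exists_common hg
  exact ⟨m, fun z => F z * G z, hF.mul hG, (hF'.and hG').mono fun ζ h => by
    beta_reduce
    rw [h.1, h.2, map_mul]⟩

theorem sub (hf : AnAt f ζ₀) (hg : AnAt g ζ₀) : AnAt (fun ζ => f ζ - g ζ) ζ₀ := by
  obtain ⟨m, F, G, hF, hG, hF', hG'⟩ := hf.exists_common hg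
  exact ⟨m, fun z => F z - G z, hF.sub hG, (hF'.and hG').mono fun ζ h => by
    beta_reduce
    rw [h.1, h.2, map_sub]⟩

theorem sum {ι : Type*} (s : Finset ι) {f : ι → Disk → N} (hf : ∀ i ∈ s, AnAt (f i) ζ₀) :
    AnAt (fun ζ => ∑ i ∈ s, f i ζ) ζ₀ := by
  classical
  induction s using Finset.induction_on with
  | empty => simpa using const 0
  | insert i s hi ih =>
    simp only [Finset.sum_insert hi]
    exact (hf i (Finset.mem_insert_self _ _)).add
      (ih fun j hj => hf j (Finset.mem_insert_of_mem hj))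

theorem prod {ι : Type*} (s : Finset ι) {f : ι → Disk → N} (hf : ∀ i ∈ s, AnAt (f i) ζ₀) :
    AnAt (fun ζ => ∏ i ∈ s, f i ζ) ζ₀ := by
  classical
  induction s using Finset.induction_on with
  | empty => simpa using const 1
  | insert i s hi ih =>
    simp only [Finset.prod_insert hi]
    exact (hf i (Finset.mem_insert_self _ _)).mul
      (ih fun j hj => hf j (Finset.mem_insert_of_mem hj))

/-- The inverse of an analytic germ is analytic where the value is invertible. -/
theorem inverse (hf : AnAt f ζ₀) (h0 : IsUnit (f ζ₀)) : AnAt (fun ζ => (f ζ)⁻¹ʳ) ζ₀ := by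
  obtain ⟨m, F, hF, hf⟩ := hf
  rw [hf.self_of_nhds] at h0
  obtain ⟨l, hl, hu⟩ := exists_isUnit_incl (F ζ₀) (isUnit_iff_E_ne_zero.1 h0)
  have hG : AnalyticAt ℂ (fun z => inclL hl (F z)) ζ₀ := ((inclL hl).analyticAt _).comp hF
  rw [← inclL_apply] at hu
  have hinv : AnalyticAt ℂ (fun z : ℂ => (inclL hl (F z))⁻¹ʳ) ζ₀ := by
    have h1 : AnalyticAt ℂ Ring.inverse (inclL hl (F ζ₀)) := by
      obtain ⟨u, hu⟩ := hu
      rw [← hu]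
      exact analyticAt_inverse u
    exact AnalyticAt.comp (f := fun z => inclL hl (F z)) h1 hG
  have hev : ∀ᶠ z : ℂ in 𝓝 (ζ₀ : ℂ), IsUnit (inclL hl (F z)) :=
    hG.continuousAt.eventually (Units.isOpen.mem_nhds hu)
  refine ⟨l, _, hinv, ?_⟩
  filter_upwards [hf, eventually_disk_iff.2 hev] with ζ h1 h2
  have h3 : toN l (inclL hl (F ζ)) = f ζ := by rw [inclL_apply, toN_incl, h1]
  have h4 : IsUnit (f ζ) := h3 ▸ h2.map (toN l)
  refine h4.mul_left_cancel ?_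
  rw [Ring.mul_inverse_cancel _ h4, ← h3, ← map_mul, Ring.mul_inverse_cancel _ h2, map_one]

/-- Two analytic germs which agree in a punctured neighborhood agree at the point itself. -/
theorem eq_of_eventually_ne (hf : AnAt f ζ₀) (hg : AnAt g ζ₀)
    (h : ∀ᶠ ζ in 𝓝 ζ₀, ζ ≠ ζ₀ → f ζ = g ζ) : f ζ₀ = g ζ₀ := by
  obtain ⟨m, F, G, hF, hG, hF', hG'⟩ := hf.exists_common hg
  have h1 : ∀ᶠ z : ℂ in 𝓝 (ζ₀ : ℂ), z ≠ ζ₀ → F z = G z := by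
    refine eventually_disk_iff.1 ?_
    filter_upwards [h, hF', hG'] with ζ h2 h3 h4 hne
    refine toN_injective m ?_
    rw [← h3, ← h4]
    exact h2 fun h5 => hne (congrArg _ h5)
  have h2 : F =ᶠ[𝓝[≠] (ζ₀ : ℂ)] G := eventually_nhdsWithin_iff.2 h1
  have h3 : F ζ₀ = G ζ₀ := tendsto_nhds_unique_of_eventuallyEq
    (hF.continuousAt.continuousWithinAt (s := {(ζ₀ : ℂ)}ᶜ))
    (hG.continuousAt.continuousWithinAt (s := {(ζ₀ : ℂ)}ᶜ)) h2
  rw [hF'.self_of_nhds, hG'.self_of_nhds, h3]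

/-- The constant coefficient of an analytic germ is an analytic germ in the usual sense. -/
theorem exists_analyticAt_E (hf : AnAt f ζ₀) :
    ∃ φ : ℂ → ℂ, AnalyticAt ℂ φ ζ₀ ∧ ∀ᶠ ζ : Disk in 𝓝 ζ₀, E (f ζ) = φ ζ := by
  obtain ⟨m, F, hF, hf⟩ := hf
  refine ⟨fun z => W.coeff m 0 (F z), ((W.coeff m 0).analyticAt _).comp hF, hf.mono fun ζ h => ?_⟩
  beta_reduce
  rw [h, coeff_apply, MvPowerSeries.coeff_zero_eq_constantCoeff_apply, ← coe_toN]
  rfl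

end AnAt

/-! ### Point evaluation as divisibility -/

theorem summable_mul_pow {A : Type*} [NormedCommRing A] [CompleteSpace A] [NormOneClass A]
    {d : ℕ → A} {s : A} {ρ B : ℝ} (hs : ‖s‖ < ρ) (hB : ∀ j, ‖d j‖ * ρ ^ j ≤ B) :
    Summable fun j => d j * s ^ j := by
  have hρ0 : 0 < ρ := (norm_nonneg s).trans_lt hs
  have hq1 : ‖s‖ / ρ < 1 := (div_lt_one hρ0).2 hs
  refine Summable.of_norm_bounded
    ((summable_geometric_of_lt_one (by positivity : 0 ≤ ‖s‖ / ρ) hq1).mul_left B) fun j => ?_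
  calc ‖d j * s ^ j‖ ≤ ‖d j‖ * ‖s‖ ^ j :=
        (norm_mul_le _ _).trans (mul_le_mul_of_nonneg_left (norm_pow_le _ _) (norm_nonneg _))
    _ = ‖d j‖ * ρ ^ j * (‖s‖ / ρ) ^ j := by
        rw [div_pow, mul_assoc, mul_div_cancel₀ _ (pow_pos hρ0 j).ne']
    _ ≤ B * (‖s‖ / ρ) ^ j := mul_le_mul_of_nonneg_right (hB j) (by positivity)

/-- The terms of the series for `(∑ d_j x^j - ∑ d_j s^j) / (x - s)`. -/
def quotTerm {A : Type*} [CommRing A] (d : ℕ → A) (s : A) (j : ℕ) (x : A) : A :=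
  d j * ∑ i ∈ Finset.range j, x ^ i * s ^ (j - 1 - i)

theorem quotTerm_mul {A : Type*} [CommRing A] (d : ℕ → A) (s : A) (j : ℕ) (x : A) :
    quotTerm d s j x * (x - s) = d j * x ^ j - d j * s ^ j := by
  rw [quotTerm, mul_assoc, geom_sum₂_mul, mul_sub]

theorem norm_quotTerm_le {A : Type*} [NormedCommRing A] [NormOneClass A] {d : ℕ → A} {s x : A}
    {σ ρ B : ℝ} (hσ : 0 < σ) (hρ : 0 < ρ) (hs : ‖s‖ ≤ σ) (hx : ‖x‖ ≤ σ)
    (hB : ∀ j, ‖d j‖ * ρ ^ j ≤ B) (j : ℕ) :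
    ‖quotTerm d s j x‖ ≤ B / σ * ((j : ℝ) ^ 1 * (σ / ρ) ^ j) := by
  have h1 : ‖∑ i ∈ Finset.range j, x ^ i * s ^ (j - 1 - i)‖ ≤ j * (σ ^ j / σ) := by
    refine (norm_sum_le _ _).trans ((Finset.sum_le_card_nsmul _ _ (σ ^ j / σ)
      fun i hi => ?_).trans_eq (by rw [Finset.card_range, nsmul_eq_mul]))
    have hi' := Finset.mem_range.1 hi
    calc ‖x ^ i * s ^ (j - 1 - i)‖ ≤ σ ^ i * σ ^ (j - 1 - i) :=
          (norm_mul_le _ _).trans (mul_le_mul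
            ((norm_pow_le _ _).trans (pow_le_pow_left₀ (norm_nonneg _) hx _))
            ((norm_pow_le _ _).trans (pow_le_pow_left₀ (norm_nonneg _) hs _))
            (norm_nonneg _) (by positivity))
      _ = σ ^ j / σ := by
          rw [eq_div_iff hσ.ne', ← pow_add, ← pow_succ]
          congr 1
          omega
  calc ‖quotTerm d s j x‖ ≤ ‖d j‖ * (j * (σ ^ j / σ)) :=
        (norm_mul_le _ _).trans (mul_le_mul_of_nonneg_left h1 (norm_nonneg _))
    _ = ‖d j‖ * ρ ^ j * (j * (σ ^ j / σ) / ρ ^ j) := by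
        rw [mul_assoc, mul_div_cancel₀ _ (pow_pos hρ j).ne']
    _ ≤ B * (j * (σ ^ j / σ) / ρ ^ j) := mul_le_mul_of_nonneg_right (hB j) (by positivity)
    _ = B / σ * ((j : ℝ) ^ 1 * (σ / ρ) ^ j) := by rw [div_pow]; ring

/-- If the coefficients satisfy a geometric bound, then `∑ d_j x^j` and `∑ d_j s^j` differ by a
multiple of `x - s`, which depends analytically on the scalar `x`. -/
theorem exists_analyticAt_sub_mul {A : Type*} [NormedCommRing A] [NormedAlgebra ℂ A]
    [CompleteSpace A] [NormOneClass A] {d : ℕ → A} {s : A} {ρ B : ℝ}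
    (hs : ‖s‖ < ρ) (hB : ∀ j, ‖d j‖ * ρ ^ j ≤ B) :
    ∃ G : ℂ → A, AnalyticAt ℂ G 0 ∧
      ∀ᶠ x in 𝓝 (0 : ℂ), ∀ t, HasSum (fun j => x ^ j • d j) t →
        t - ∑' j, d j * s ^ j = (algebraMap ℂ A x - s) * G x := by
  obtain ⟨σ, hσ1, hσ2⟩ := exists_between hs
  have hσ0 : 0 < σ := (norm_nonneg s).trans_lt hσ1
  have hρ0 : 0 < ρ := hσ0.trans hσ2
  have hq0 : 0 ≤ σ / ρ := by positivity
  have hq1 : σ / ρ < 1 := (div_lt_one hρ0).2 hσ2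
  have hq : ‖σ / ρ‖ < 1 := by rwa [Real.norm_of_nonneg hq0]
  have hu : Summable fun j : ℕ => B / σ * ((j : ℝ) ^ 1 * (σ / ρ) ^ j) :=
    Summable.mul_left (B / σ) (summable_pow_mul_geometric_of_norm_lt_one 1 hq)
  have hTb : ∀ j, ∀ x ∈ Metric.ball (0 : ℂ) σ, ‖quotTerm d s j (algebraMap ℂ A x)‖ ≤
      B / σ * ((j : ℝ) ^ 1 * (σ / ρ) ^ j) := fun j x hx =>
    norm_quotTerm_le hσ0 hρ0 hσ1.le
      (by rw [norm_algebraMap']; exact (mem_ball_zero_iff.1 hx).le) hB j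
  have hTd : ∀ j, DifferentiableOn ℂ (fun x : ℂ => quotTerm d s j (algebraMap ℂ A x))
      (Metric.ball 0 σ) := fun j => by
    have hXd : Differentiable ℂ (fun x : ℂ => algebraMap ℂ A x) :=
      (Algebra.linearMap ℂ A).toContinuousLinearMap.differentiable
    simp only [quotTerm]
    refine Differentiable.differentiableOn ?_
    exact Differentiable.const_mul (Differentiable.fun_sum fun i _ =>
      (hXd.fun_pow i).mul_const _) _
  have hG : DifferentiableOn ℂ (fun x : ℂ => ∑' j, quotTerm d s j (algebraMap ℂ A x))
      (Metric.ball 0 σ) :=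
    Complex.differentiableOn_tsum_of_summable_norm
      (F := fun j (x : ℂ) => quotTerm d s j (algebraMap ℂ A x)) hu hTd Metric.isOpen_ball hTb
  refine ⟨fun x => ∑' j, quotTerm d s j (algebraMap ℂ A x),
    hG.analyticAt (Metric.ball_mem_nhds 0 hσ0), ?_⟩
  filter_upwards [Metric.ball_mem_nhds (0 : ℂ) hσ0] with x hx t ht
  have hTs : Summable fun j => quotTerm d s j (algebraMap ℂ A x) :=
    Summable.of_norm_bounded hu fun j => hTb j x hx
  have h1 := hTs.hasSum.mul_right (algebraMap ℂ A x - s)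
  simp only [quotTerm_mul] at h1
  have h2 : (fun j => x ^ j • d j) = fun j => d j * algebraMap ℂ A x ^ j := by
    ext1 j
    rw [← map_pow, mul_comm, ← Algebra.smul_def]
  rw [h2] at ht
  rw [mul_comm (algebraMap ℂ A x - s)]
  exact (ht.sub (summable_mul_pow hs hB).hasSum).unique h1

theorem exists_geometric_bound {A : Type*} [NormedAddCommGroup A] [NormedSpace ℂ A] {d : ℕ → A}
    {F : ℂ → A} (h : ∀ᶠ x in 𝓝 (0 : ℂ), HasSum (fun j => x ^ j • d j) (F x)) :
    ∃ ρ B : ℝ, 0 < ρ ∧ ∀ j, ‖d j‖ * ρ ^ j ≤ B := by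
  obtain ⟨x, hx, hne⟩ :=
    ((h.filter_mono nhdsWithin_le_nhds).and (self_mem_nhdsWithin (s := {(0 : ℂ)}ᶜ))).exists
  obtain ⟨B, hB⟩ := hx.summable.tendsto_atTop_zero.norm.bddAbove_range
  refine ⟨‖x‖, B, norm_pos_iff.2 hne, fun j => ?_⟩
  have h1 : ‖x ^ j • d j‖ ≤ B := hB ⟨j, rfl⟩
  rwa [norm_smul, norm_pow, mul_comm] at h1

/-- The Taylor coefficients of `v + (x - s) g`, if `h_j` are those of `g`. -/
def mulCoeff {A : Type*} [CommRing A] (h : ℕ → A) (s v : A) : ℕ → A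
  | 0 => v - s * h 0
  | j + 1 => h j - s * h (j + 1)

theorem hasSum_mulCoeff {A : Type*} [NormedCommRing A] {h : ℕ → A} {s v x Γ : A}
    (hs : HasSum (fun j => h j * x ^ j) Γ) :
    HasSum (fun j => mulCoeff h s v j * x ^ j) (v + (x - s) * Γ) := by
  have h1 := (hs.mul_left x).sub (((hasSum_nat_add_iff' 1).2 hs).mul_left s)
  refine (hasSum_nat_add_iff' 1).1 ?_
  convert h1 using 1
  · ext1 j
    simp only [mulCoeff]
    ring
  · simp only [Finset.sum_range_one, mulCoeff]
    ring

/-- If `f(r) = v`, then `f - v` is divisible by `λ - r` in the ring of analytic germs at `E r`. The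
Taylor series of `f` converges at `r - E(r)`, which is small in a large Wiener algebra. -/
theorem HasValueAt.exists_dvd {f : Disk → N} {r v : N} (h : HasValueAt f r v) :
    ∃ (hr : E r ∈ Metric.ball (0 : ℂ) 1) (g : Disk → N), AnAt g ⟨E r, hr⟩ ∧
      ∀ᶠ ζ in 𝓝 (⟨E r, hr⟩ : Disk), f ζ - v = (algebraMap ℂ N ζ - r) * g ζ := by
  obtain ⟨hr, c, q, hc, hv⟩ := h
  refine ⟨hr, ?_⟩
  obtain ⟨m, d, F, hd, hF, hf⟩ := hc.exists_wiener
  obtain ⟨ρ, B, hρ, hB⟩ := exists_geometric_bound hF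
  have hEs : E (r - algebraMap ℂ N (E r)) = 0 := by rw [map_sub, E_algebraMap, sub_self]
  obtain ⟨k, hk⟩ := exists_norm_lt hEs hρ
  obtain ⟨s, hs, hsρ⟩ := hk (max m k) (le_max_right _ _)
  have hml : m ≤ max m k := le_max_left _ _
  generalize max m k = l at s hs hsρ hml
  have hB' : ∀ j, ‖incl hml (d j)‖ * ρ ^ j ≤ B := fun j =>
    (mul_le_mul_of_nonneg_right (norm_incl_le hml (d j)) (pow_nonneg hρ.le j)).trans (hB j)
  have hsum := summable_mul_pow hsρ hB'
  obtain ⟨G, hG, hFG⟩ := exists_analyticAt_sub_mul hsρ hB'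
  have hval : toN l (∑' j, incl hml (d j) * s ^ j) = v := by
    refine (hasSumIn_of_hasSum hsum.hasSum).unique (l := q) ?_
    simpa only [map_mul, map_pow, toN_incl, hd, hs] using hv
  refine ⟨fun ζ => toN l (G (ζ - E r)), ⟨l, fun z => G (z - E r), ?_,
    Filter.Eventually.of_forall fun _ => rfl⟩, ?_⟩
  · have h0 : AnalyticAt ℂ G (E r - E r) := by rwa [sub_self]
    exact AnalyticAt.comp (f := fun z => z - E r) h0 (analyticAt_id.sub analyticAt_const)
  · have h1 : ∀ᶠ z in 𝓝 (E r), toN m (F z) - v = (algebraMap ℂ N z - r) * toN l (G (z - E r)) := by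
      rw [eventually_nhds_iff_add]
      filter_upwards [hF, hFG] with x hx1 hx2
      have h2 := hx2 (inclL hml (F (E r + x))) (by
        have h3 := hx1.mapL (inclL hml)
        simpa only [map_smul, inclL_apply] using h3)
      have h3 := congrArg (toN l) h2
      rw [map_sub, hval, inclL_apply, toN_incl, map_mul, map_sub, hs, AlgHom.commutes] at h3
      rw [h3, add_sub_cancel_left, map_add]
      ring
    filter_upwards [hf, eventually_disk_iff.2 h1] with ζ h2 h3
    rw [h2, h3]

/-- The converse of `HasValueAt.exists_dvd`: the Taylor series of `v + (λ - r) g` takes the value `v`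
at `λ = r`. -/
theorem hasValueAt_of_dvd {f g : Disk → N} {r v : N} (hr : E r ∈ Metric.ball (0 : ℂ) 1)
    (hg : AnAt g ⟨E r, hr⟩)
    (hfg : ∀ᶠ ζ in 𝓝 (⟨E r, hr⟩ : Disk), f ζ - v = (algebraMap ℂ N ζ - r) * g ζ) :
    HasValueAt f r v := by
  obtain ⟨m, G, hG, hgG⟩ := hg
  obtain ⟨h, hh⟩ := AnalyticAt.exists_hasSum hG
  obtain ⟨ρ, B, hρ, hB⟩ := exists_geometric_bound hh
  have hEs : E (r - algebraMap ℂ N (E r)) = 0 := by rw [map_sub, E_algebraMap, sub_self]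
  obtain ⟨k, hk⟩ := exists_norm_lt hEs hρ
  obtain ⟨k', hk'⟩ := exists_toN_eq v
  obtain ⟨l, hml, hkl, hkl'⟩ : ∃ l, m ≤ l ∧ k ≤ l ∧ k' ≤ l :=
    ⟨m + k + k', by omega, by omega, by omega⟩
  obtain ⟨s, hs, hsρ⟩ := hk l hkl
  obtain ⟨w, hw⟩ := hk' l hkl'
  have hsum := summable_mul_pow hsρ fun j =>
    (mul_le_mul_of_nonneg_right (norm_incl_le hml (h j)) (pow_nonneg hρ.le j)).trans (hB j)
  let d := mulCoeff (fun j => incl hml (h j)) s w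
  refine ⟨hr, fun j => toN l (d j), 2 * l, hasTaylorAt_of_hasSum
    (F := fun z => w + (algebraMap ℂ (W l) (z - E r) - s) * inclL hml (G z)) ?_ ?_, ?_⟩
  · filter_upwards [hh] with x hx
    have h1 := hx.mapL (inclL hml)
    have h2 : (fun j => inclL hml (x ^ j • h j)) =
        fun j => incl hml (h j) * algebraMap ℂ (W l) x ^ j := by
      ext1 j
      rw [map_smul, inclL_apply, Algebra.smul_def, map_pow, mul_comm]
    rw [h2] at h1
    have h3 := hasSum_mulCoeff (s := s) (v := w) h1
    have h4 : (fun j => x ^ j • d j) = fun j => d j * algebraMap ℂ (W l) x ^ j := by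
      ext1 j
      rw [Algebra.smul_def, map_pow, mul_comm]
    rw [h4]
    simpa only [add_sub_cancel_left] using h3
  · filter_upwards [hfg, hgG] with ζ h1 h2
    rw [map_add, map_mul, map_sub, hw, hs, AlgHom.commutes, inclL_apply, toN_incl, ← h2, map_sub,
      sub_sub_sub_cancel_right, ← h1, add_sub_cancel]
  · have h1 := hasSumIn_of_hasSum (hasSum_mulCoeff (s := s) (v := w) hsum.hasSum)
    simpa only [sub_self, zero_mul, add_zero, map_mul, map_pow, hs, hw] using h1

/-! ### Pick's theorem for scalar functions -/

open Real in
/-- The reproducing property of the Szegő kernel `1 / (1 - x ζ̄)` on the unit circle. -/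
theorem circleAverage_mul_star_szego {h : ℂ → ℂ} (hh : DiffContOnCl ℂ h (Metric.ball 0 1)) {ζ : ℂ}
    (hζ : ‖ζ‖ < 1) :
    circleAverage (fun x => h x * star ((1 - x * star ζ)⁻¹)) 0 1 = h ζ := by
  have h1 := DiffContOnCl.circleAverage_smul_div (f := h) (c := 0) (R := 1) (w := ζ)
    (by simpa using hh) (by simpa using hζ)
  rw [← h1]
  refine circleAverage_congr_sphere fun x hx => ?_
  have hx1 : ‖x‖ = 1 := by simpa using hx
  have hxs : x * star x = 1 := by
    rw [Complex.star_def, Complex.mul_conj, Complex.normSq_eq_norm_sq, hx1]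
    simp
  have hx0 : x ≠ 0 := norm_ne_zero_iff.1 (by rw [hx1]; exact one_ne_zero)
  have hne : x - ζ ≠ 0 := fun h0 => by
    rw [sub_eq_zero.1 h0] at hx1
    exact hζ.ne hx1
  have h2 : star ((1 - x * star ζ)⁻¹) = x / (x - ζ) := by
    rw [star_inv₀, star_sub, star_mul, star_star, star_one, eq_div_iff hne]
    have h3 : x * (1 - ζ * star x) = x - ζ := by linear_combination (-ζ) * hxs
    have h4 : 1 - ζ * star x ≠ 0 := fun h0 => hne (by rw [← h3, h0, mul_zero])
    rw [inv_mul_eq_iff_eq_mul₀ h4, mul_comm, h3]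
  simp only [h2, sub_zero, smul_eq_mul]
  ring

open Real in
/-- With `u = ∑ γ_j k_j` and `v = ∑ γ_j ψ(ζ_j)^* k_j`, where `k_j` are the Szegő kernels, the
positivity of the mean of `|u - ψ v|² + (1 - |ψ|²) |v|²` over the circle is the positivity of the
Pick matrix. -/
theorem pick_form_nonneg_of_diffContOnCl {ι : Type*} [Fintype ι] {ψ : ℂ → ℂ}
    (hψ : DiffContOnCl ℂ ψ (Metric.ball 0 1)) (hb : ∀ x ∈ Metric.sphere (0 : ℂ) 1, ‖ψ x‖ ≤ 1)
    {ζ : ι → ℂ} (hζ : ∀ i, ‖ζ i‖ < 1) (γ : ι → ℂ) :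
    0 ≤ (∑ i, star (γ i) * ∑ j, γ j * (1 - ψ (ζ i) * star (ψ (ζ j))) *
      (1 - ζ i * star (ζ j))⁻¹).re := by
  let k : ι → ℂ → ℂ := fun j x => (1 - x * star (ζ j))⁻¹
  have hne : ∀ j, ∀ x ∈ Metric.closedBall (0 : ℂ) 1, 1 - x * star (ζ j) ≠ 0 := by
    intro j x hx h0
    have h1 : ‖x * star (ζ j)‖ < 1 := by
      rw [norm_mul, norm_star]
      have := mem_closedBall_zero_iff.1 hx
      nlinarith [hζ j, norm_nonneg x, norm_nonneg (ζ j)]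
    rw [← sub_eq_zero.1 h0, norm_one] at h1
    exact lt_irrefl _ h1
  have hk : ∀ j, DiffContOnCl ℂ (k j) (Metric.ball 0 1) := fun j =>
    DifferentiableOn.diffContOnCl_ball (U := Metric.closedBall 0 1)
      (fun x hx => ((by fun_prop : DifferentiableAt ℂ (fun x : ℂ => 1 - x * star (ζ j)) x).inv
        (hne j x hx)).differentiableWithinAt) le_rfl
  -- A linear combination of the kernels, and the mean of its product with an analytic function.
  let comb : (ι → ℂ) → ℂ → ℂ := fun c x => ∑ j, c j * k j x
  have hcomb : ∀ c, DiffContOnCl ℂ (comb c) (Metric.ball 0 1) := fun c =>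
    ⟨DifferentiableOn.fun_sum fun j _ => (hk j).differentiableOn.const_mul _,
      continuousOn_finsetSum _ fun j _ => continuousOn_const.mul (hk j).continuousOn⟩
  have hcont : ∀ {h : ℂ → ℂ}, DiffContOnCl ℂ h (Metric.ball 0 1) →
      ContinuousOn h (Metric.sphere 0 1) := fun hh => by
    have := hh.continuousOn
    rw [closure_ball _ one_ne_zero] at this
    exact this.mono Metric.sphere_subset_closedBall
  have hint : ∀ {h : ℂ → ℂ}, DiffContOnCl ℂ h (Metric.ball 0 1) → ∀ c,
      CircleIntegrable (fun x => h x * star (comb c x)) 0 1 := fun hh c =>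
    ((hcont hh).mul (hcont (hcomb c)).star).circleIntegrable zero_le_one
  have havg : ∀ {h : ℂ → ℂ}, DiffContOnCl ℂ h (Metric.ball 0 1) → ∀ c,
      circleAverage (fun x => h x * star (comb c x)) 0 1 = ∑ i, star (c i) * h (ζ i) := by
    intro h hh c
    have h1 : (fun x => h x * star (comb c x)) =
        fun x => ∑ i, star (c i) • (h x * star (k i x)) := by
      ext1 x
      simp only [comb, star_sum, Finset.mul_sum, star_mul, smul_eq_mul]
      exact Finset.sum_congr rfl fun i _ => by ring
    have h2 : ∀ i ∈ Finset.univ,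
        CircleIntegrable (fun x => star (c i) • (h x * star (k i x))) 0 1 := fun i _ =>
      (((hcont hh).mul (hcont (hk i)).star).circleIntegrable zero_le_one).const_smul
    rw [h1, circleAverage_fun_sum h2]
    refine Finset.sum_congr rfl fun i _ => ?_
    rw [circleAverage_fun_smul, circleAverage_mul_star_szego hh (hζ i), smul_eq_mul]
  set δ : ι → ℂ := fun j => γ j * star (ψ (ζ j)) with hδ
  have hu := hcomb γ
  have hv := hcomb δ
  have hψv : DiffContOnCl ℂ (fun x => ψ x * comb δ x) (Metric.ball 0 1) :=
    ⟨hψ.differentiableOn.mul hv.differentiableOn, hψ.continuousOn.mul hv.continuousOn⟩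
  have hpos : 0 ≤ circleAverage (fun x => (comb γ x * star (comb γ x) -
      (2 : ℂ) • (ψ x * comb δ x * star (comb γ x)) + comb δ x * star (comb δ x)).re) 0 1 := by
    refine circleAverage_nonneg_of_nonneg fun x hx => ?_
    have hx' : ‖ψ x‖ ≤ 1 := hb x (by simpa using hx)
    generalize ψ x = p at hx'
    generalize comb γ x = u
    generalize comb δ x = v
    have h2 : Complex.normSq p ≤ 1 := by
      rw [Complex.normSq_eq_norm_sq]
      exact pow_le_one₀ (norm_nonneg p) hx'
    have h3 : (u * star u - (2 : ℂ) • (p * v * star u) + v * star v).re =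
        Complex.normSq (u - p * v) + (1 - Complex.normSq p) * Complex.normSq v := by
      simp [Complex.normSq_apply]
      ring
    rw [h3]
    have := Complex.normSq_nonneg (u - p * v)
    have := Complex.normSq_nonneg v
    nlinarith
  have hi2 : CircleIntegrable (fun x => (2 : ℂ) • (ψ x * comb δ x * star (comb γ x))) 0 1 :=
    (hint hψv γ).const_smul
  have hi12 : CircleIntegrable (fun x => comb γ x * star (comb γ x) -
      (2 : ℂ) • (ψ x * comb δ x * star (comb γ x))) 0 1 := (hint hu γ).sub hi2
  have hi := hi12.add (hint hv δ)
  have hre : circleAverage (fun x => (comb γ x * star (comb γ x) -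
      (2 : ℂ) • (ψ x * comb δ x * star (comb γ x)) + comb δ x * star (comb δ x)).re) 0 1 =
      (circleAverage (fun x => comb γ x * star (comb γ x) -
      (2 : ℂ) • (ψ x * comb δ x * star (comb γ x)) + comb δ x * star (comb δ x)) 0 1).re :=
    Complex.reCLM.circleAverage_comp_comm hi
  rw [hre, circleAverage_fun_add hi12 (hint hv δ), circleAverage_fun_sub (hint hu γ) hi2,
    circleAverage_fun_smul, havg hu, havg hψv, havg hv] at hpos
  have hV : ∑ i, star (δ i) * comb δ (ζ i) = ∑ i, star (γ i) * (ψ (ζ i) * comb δ (ζ i)) :=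
    Finset.sum_congr rfl fun i _ => by
      simp only [hδ, star_mul, star_star]
      ring
  have hgoal : ∑ i, star (γ i) * ∑ j, γ j * (1 - ψ (ζ i) * star (ψ (ζ j))) *
      (1 - ζ i * star (ζ j))⁻¹ =
      ∑ i, star (γ i) * comb γ (ζ i) - (2 : ℂ) • ∑ i, star (γ i) * (ψ (ζ i) * comb δ (ζ i)) +
        ∑ i, star (δ i) * comb δ (ζ i) := by
    rw [hV, two_smul, ← sub_sub, sub_add_cancel, ← Finset.sum_sub_distrib]
    refine Finset.sum_congr rfl fun i _ => ?_
    rw [← mul_sub]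
    congr 1
    simp only [comb, k, hδ, Finset.mul_sum, ← Finset.sum_sub_distrib]
    exact Finset.sum_congr rfl fun j _ => by ring
  rw [hgoal]
  exact hpos

theorem pick_form_nonneg {ι : Type*} [Fintype ι] {φ : ℂ → ℂ}
    (hφ : DifferentiableOn ℂ φ (Metric.ball 0 1)) (hb : ∀ x ∈ Metric.ball (0 : ℂ) 1, ‖φ x‖ ≤ 1)
    {ζ : ι → ℂ} (hζ : ∀ i, ‖ζ i‖ < 1) (γ : ι → ℂ) :
    0 ≤ (∑ i, star (γ i) * ∑ j, γ j * (1 - φ (ζ i) * star (φ (ζ j))) *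
      (1 - ζ i * star (ζ j))⁻¹).re := by
  let Φ : ℝ → ℂ := fun r => ∑ i, star (γ i) * ∑ j, γ j *
    (1 - φ (r * ζ i) * star (φ (r * ζ j))) * (1 - ζ i * star (ζ j))⁻¹
  have hΦ : ContinuousAt Φ 1 := by
    have h1 : ∀ i, ContinuousAt (fun r : ℝ => φ (r * ζ i)) 1 := fun i => by
      have h2 : ContinuousAt φ (((1 : ℝ) : ℂ) * ζ i) := by
        rw [Complex.ofReal_one, one_mul]
        exact (hφ.differentiableAt (Metric.isOpen_ball.mem_nhds
          (mem_ball_zero_iff.2 (hζ i)))).continuousAt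
      exact ContinuousAt.comp (f := fun r : ℝ => (r : ℂ) * ζ i) h2 (by fun_prop)
    refine tendsto_finsetSum _ fun i _ => Filter.Tendsto.const_mul _
      (tendsto_finsetSum _ fun j _ => ?_)
    exact (Filter.Tendsto.const_mul _ (tendsto_const_nhds.sub ((h1 i).mul (h1 j).star))).mul_const _
  have hre : Filter.Tendsto (fun r => (Φ r).re) (𝓝[<] 1) (𝓝 (Φ 1).re) :=
    (Complex.continuous_re.continuousAt.comp hΦ).tendsto.mono_left nhdsWithin_le_nhds
  have h2 : 0 ≤ (Φ 1).re := by
    refine ge_of_tendsto hre ?_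
    filter_upwards [Ioo_mem_nhdsLT (zero_lt_one (α := ℝ))] with r hr
    have hmap : Set.MapsTo (fun x : ℂ => (r : ℂ) * x) (Metric.closedBall 0 1)
        (Metric.ball 0 1) := fun x hx => by
      have hx' := mem_closedBall_zero_iff.1 hx
      rw [mem_ball_zero_iff, norm_mul, Complex.norm_real, Real.norm_of_nonneg hr.1.le]
      nlinarith [hr.1, hr.2, norm_nonneg x]
    have hd : DiffContOnCl ℂ (fun x : ℂ => φ (r * x)) (Metric.ball 0 1) :=
      DifferentiableOn.diffContOnCl_ball (U := Metric.closedBall 0 1)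
        (hφ.comp (by fun_prop) hmap) le_rfl
    exact pick_form_nonneg_of_diffContOnCl hd
      (fun x hx => hb _ (hmap (Metric.sphere_subset_closedBall hx))) hζ γ
  simpa [Φ] using h2

open scoped ComplexOrder in
/-- **Pick's theorem**: the Pick matrix of a function bounded by `1` is positive semidefinite. -/
theorem pick_posSemidef {ι : Type*} [Fintype ι] {φ : ℂ → ℂ}
    (hφ : DifferentiableOn ℂ φ (Metric.ball 0 1)) (hb : ∀ x ∈ Metric.ball (0 : ℂ) 1, ‖φ x‖ ≤ 1)
    {ζ : ι → ℂ} (hζ : ∀ i, ‖ζ i‖ < 1) :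
    (Matrix.of fun i j => (1 - φ (ζ i) * star (φ (ζ j))) *
      (1 - ζ i * star (ζ j))⁻¹).PosSemidef := by
  have hH : (Matrix.of fun i j => (1 - φ (ζ i) * star (φ (ζ j))) *
      (1 - ζ i * star (ζ j))⁻¹).IsHermitian := by
    ext i j
    simp [Matrix.conjTranspose_apply, mul_comm]
  refine Matrix.PosSemidef.of_dotProduct_mulVec_nonneg hH fun γ => ?_
  rw [Complex.nonneg_iff]
  refine ⟨?_, (hH.im_star_dotProduct_mulVec_self γ).symm⟩
  refine (pick_form_nonneg hφ hb hζ γ).trans_eq (congrArg Complex.re ?_)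
  simp only [dotProduct, Matrix.mulVec, Matrix.of_apply, Pi.star_apply]
  refine Finset.sum_congr rfl fun i _ => congrArg _ (Finset.sum_congr rfl fun j _ => by ring)

open scoped ComplexOrder in
/-- The Schwarz–Pick inequality with interpolation conditions: the Schur complement of the Pick
matrix `P` in the Pick matrix with the additional node `z`. -/
theorem pick_schur_complement {n : ℕ} {φ : ℂ → ℂ}
    (hφ : DifferentiableOn ℂ φ (Metric.ball 0 1)) (hb : ∀ x ∈ Metric.ball (0 : ℂ) 1, ‖φ x‖ ≤ 1)
    {ζ : Fin n → ℂ} (hζ : ∀ i, ‖ζ i‖ < 1) {z : ℂ} (hz : ‖z‖ < 1) {P Q : Matrix (Fin n) (Fin n) ℂ}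
    (hP : P.PosDef) (hPφ : ∀ i j, P i j = (1 - φ (ζ i) * star (φ (ζ j))) *
      (1 - ζ i * star (ζ j))⁻¹) (hPQ : P * Q = 1) {y : Fin n → ℂ}
    (hy : ∀ j, y j = (1 - φ z * star (φ (ζ j))) * (1 - z * star (ζ j))⁻¹) :
    (y ⬝ᵥ Matrix.mulVec Q (star y)).re ≤ (1 - ‖φ z‖ ^ 2) * (1 - ‖z‖ ^ 2)⁻¹ := by
  let B : Matrix (Fin n) Unit ℂ := Matrix.of fun i _ => star (y i)
  let D : Matrix Unit Unit ℂ := Matrix.of fun _ _ => (1 - φ z * star (φ z)) * (1 - z * star z)⁻¹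
  have h1 := pick_posSemidef hφ hb (ζ := Sum.elim ζ fun _ : Unit => z)
    (by rintro (i | i); exacts [hζ i, hz])
  have h2 : (Matrix.of fun i j : Fin n ⊕ Unit =>
      (1 - φ (Sum.elim ζ (fun _ => z) i) * star (φ (Sum.elim ζ (fun _ => z) j))) *
      (1 - Sum.elim ζ (fun _ => z) i * star (Sum.elim ζ (fun _ => z) j))⁻¹) =
      Matrix.fromBlocks P B B.conjTranspose D := by
    ext i j
    rcases i with i | i <;> rcases j with j | j
    · simp [hPφ]
    · simp [B, hy, mul_comm]
    · simp [B, hy, mul_comm]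
    · simp [D]
  rw [h2] at h1
  have : Invertible P := ⟨Q, mul_eq_one_comm.1 hPQ, hPQ⟩
  have h3 := ((Matrix.PosDef.fromBlocks₁₁ B D hP).1 h1).re_dotProduct_nonneg (fun _ => 1)
  have hQ : P⁻¹ = Q := Matrix.inv_eq_right_inv hPQ
  rw [hQ] at h3
  have h4 : ((D - B.conjTranspose * Q * B) () ()) = (1 - φ z * star (φ z)) * (1 - z * star z)⁻¹ -
      y ⬝ᵥ Matrix.mulVec Q (star y) := by
    rw [Matrix.sub_apply, Matrix.mul_assoc, Matrix.mul_apply]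
    simp only [D, Matrix.of_apply, dotProduct, Matrix.mulVec, Matrix.mul_apply, B,
      Matrix.conjTranspose_apply, star_star, Pi.star_apply]
  have h5 : 0 ≤ ((D - B.conjTranspose * Q * B) () ()).re := by
    simpa [dotProduct, Matrix.mulVec] using h3
  rw [h4, Complex.sub_re] at h5
  have h6 : ((1 - φ z * star (φ z)) * (1 - z * star z)⁻¹).re =
      (1 - ‖φ z‖ ^ 2) * (1 - ‖z‖ ^ 2)⁻¹ := by
    have h7 : ∀ w : ℂ, w * star w = ((‖w‖ ^ 2 : ℝ) : ℂ) := fun w => by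
      rw [Complex.star_def, Complex.mul_conj, Complex.normSq_eq_norm_sq]
    rw [h7, h7]
    norm_cast
  linarith

/-! ### Matrix identities for `Θ` -/

/-- With `B = A*`, this expresses `1 - λ` times the left side of the Stein equation
`P - A* P A = C* J C` through factors which cancel in `C* J Θ(λ)`. -/
theorem stein_bracket {R n : Type*} [CommRing R] [Fintype n] [DecidableEq n]
    (A B P : Matrix n n R) (z : R) :
    (1 - B) * P * (1 - z • A) - (1 - z) • (P - B * P * A) = (z • 1 - B) * P * (1 - A) := by
  simp only [sub_mul, mul_sub, one_mul, mul_one, smul_mul_assoc, mul_smul_comm, sub_smul,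
    smul_sub, one_smul]
  abel

/-- The identity `C* J Θ(λ) = (λ - A*) P (I - A) (I - λ A)⁻¹ P⁻¹ (I - A)^{-*} C* J`, where
`B = A*` and `D = C* J`, and `Rz`, `Q`, `S` are the inverses of `I - λ A`, `P`, `I - A*`. -/
theorem mul_thetaForm {R n m : Type*} [CommRing R] [Fintype n] [DecidableEq n] [Fintype m]
    [DecidableEq m] {A B P Rz Q S : Matrix n n R} {C : Matrix m n R} {D : Matrix n m R} {z : R}
    (hst : P - B * P * A = D * C) (hR : (1 - z • A) * Rz = 1) (hQ : P * Q = 1)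
    (hS : (1 - B) * S = 1) :
    D * (1 - (1 - z) • (C * Rz * Q * S * D)) =
      (z • 1 - B) * P * (1 - A) * Rz * Q * S * D := by
  rw [← stein_bracket, hst]
  have h1 : (1 - B) * P * (1 - z • A) * Rz * Q * S = 1 := by
    rw [Matrix.mul_assoc _ (1 - z • A), hR, Matrix.mul_one, Matrix.mul_assoc _ P, hQ,
      Matrix.mul_one, hS]
  calc D * (1 - (1 - z) • (C * Rz * Q * S * D))
      = (1 - B) * P * (1 - z • A) * Rz * Q * S * D - (1 - z) • (D * C * Rz * Q * S * D) := by
        rw [h1, Matrix.mul_sub, Matrix.mul_one, Matrix.one_mul, Matrix.mul_smul]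
        simp only [Matrix.mul_assoc]
    _ = _ := by simp only [Matrix.sub_mul, Matrix.smul_mul]

/-- The determinant of `Θ(λ)`, by the same identity and `det (1 - X Y) = det (1 - Y X)`; the letters
stand for the same matrices as in `mul_thetaForm`. -/
theorem det_thetaForm {R n m : Type*} [CommRing R] [Fintype n] [DecidableEq n] [Fintype m]
    [DecidableEq m] {A B P Rz Q S : Matrix n n R} {C : Matrix m n R} {D : Matrix n m R} {z : R}
    (hst : P - B * P * A = D * C) (hR : (1 - z • A) * Rz = 1) (hQ : P * Q = 1)
    (hS : (1 - B) * S = 1) :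
    (1 - (1 - z) • (C * Rz * Q * S * D)).det = (z • 1 - B).det * ((1 - A).det * Rz.det * S.det) := by
  have h1 : 1 - (1 - z) • (C * Rz * Q * S * D) = 1 - ((1 - z) • (C * Rz)) * (Q * S * D) := by
    rw [Matrix.smul_mul]
    simp only [Matrix.mul_assoc]
  have h2 : 1 - (Q * S * D) * ((1 - z) • (C * Rz)) = Q * S * ((z • 1 - B) * P * (1 - A)) * Rz := by
    have hQ' : Q * P = 1 := mul_eq_one_comm.1 hQ
    have hS' : S * (1 - B) = 1 := mul_eq_one_comm.1 hS
    have h3 : Q * S * ((1 - B) * P * (1 - z • A)) * Rz = 1 := by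
      rw [← Matrix.mul_assoc (Q * S), ← Matrix.mul_assoc (Q * S), Matrix.mul_assoc Q, hS',
        Matrix.mul_one, hQ', Matrix.one_mul, hR]
    rw [← stein_bracket, hst, Matrix.mul_sub, Matrix.sub_mul, h3]
    simp only [Matrix.mul_smul, Matrix.smul_mul, Matrix.mul_assoc]
  have h4 : Q.det * P.det = 1 := by rw [mul_comm, ← Matrix.det_mul, hQ, Matrix.det_one]
  rw [h1, Matrix.det_one_sub_mul_comm, h2]
  simp only [Matrix.det_mul]
  linear_combination ((z • 1 - B).det * ((1 - A).det * Rz.det * S.det)) * h4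

/-- The identity `J - Θ J Θ* = (1 - |λ|²) C (I - λ A)⁻¹ P⁻¹ (I - λ A)^{-*} C*`, where `Rz`, `Q`, `S`
are the inverses of `I - λ A`, `P`, `I - A`. -/
theorem thetaForm_mul_conjTranspose {R n m : Type*} [CommRing R] [StarRing R] [Fintype n]
    [DecidableEq n] [Fintype m] [DecidableEq m] {A P Rz Q S : Matrix n n R} {C : Matrix m n R}
    {J : Matrix m m R} {z : R}
    (hst : P - A.conjTranspose * P * A = C.conjTranspose * J * C)
    (hR : (1 - z • A) * Rz = 1) (hQ : P * Q = 1) (hS : (1 - A) * S = 1)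
    (hPH : P.conjTranspose = P) (hJH : J.conjTranspose = J) (hJ : J * J = 1) :
    J - (1 - (1 - z) • (C * Rz * Q * S.conjTranspose * (C.conjTranspose * J))) * J *
      (1 - (1 - z) • (C * Rz * Q * S.conjTranspose * (C.conjTranspose * J))).conjTranspose =
      (1 - z * star z) • (C * Rz * Q * (C * Rz).conjTranspose) := by
  have hQ' : Q * P = 1 := mul_eq_one_comm.1 hQ
  have hR' : Rz * (1 - z • A) = 1 := mul_eq_one_comm.1 hR
  have hRH : (1 - z • A).conjTranspose * Rz.conjTranspose = 1 := by
    rw [← Matrix.conjTranspose_mul, hR', Matrix.conjTranspose_one]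
  have hS' : S * (1 - A) = 1 := mul_eq_one_comm.1 hS
  have hSH : S.conjTranspose * (1 - A).conjTranspose = 1 := by
    rw [← Matrix.conjTranspose_mul, hS, Matrix.conjTranspose_one]
  have hQH : Q.conjTranspose = Q := by
    have h1 : Q.conjTranspose * P = 1 := by
      rw [← hPH, ← Matrix.conjTranspose_mul, hQ, Matrix.conjTranspose_one]
    calc Q.conjTranspose = Q.conjTranspose * (P * Q) := by rw [hQ, Matrix.mul_one]
      _ = Q := by rw [← Matrix.mul_assoc, h1, Matrix.one_mul]
  set X := Rz * Q * S.conjTranspose with hX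
  set Y := S * Q * Rz.conjTranspose with hY
  have hXY : X.conjTranspose = Y := by
    rw [hX, hY, Matrix.conjTranspose_mul, Matrix.conjTranspose_mul,
      Matrix.conjTranspose_conjTranspose, hQH, Matrix.mul_assoc]
  -- `X`, `X*` and `R Q R*` are brought to the common form `X M Y`.
  have cancel : ∀ {a b : Matrix n n R}, a * b = 1 → ∀ x, a * (b * x) = x := fun h x => by
    rw [← mul_assoc, h, one_mul]
  have e1 : X * ((1 - z • A).conjTranspose * P * (1 - A)) * Y = X := by
    simp only [hX, hY, mul_assoc, cancel hS, cancel hQ, hRH, mul_one]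
  have e2 : X * ((1 - A).conjTranspose * P * (1 - z • A)) * Y = Y := by
    simp only [hX, hY, mul_assoc, cancel hSH, cancel hQ', cancel hR']
  have e3 : X * ((1 - A).conjTranspose * P * (1 - A)) * Y = Rz * Q * Rz.conjTranspose := by
    simp only [hX, hY, mul_assoc, cancel hSH, cancel hQ', cancel hS]
  have hbr : (1 - z) • ((1 - z • A).conjTranspose * P * (1 - A)) +
      star (1 - z) • ((1 - A).conjTranspose * P * (1 - z • A)) -
      ((1 - z) * star (1 - z)) • (P - A.conjTranspose * P * A) =
      (1 - z * star z) • ((1 - A).conjTranspose * P * (1 - A)) := by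
    simp only [Matrix.conjTranspose_sub, Matrix.conjTranspose_one, Matrix.conjTranspose_smul,
      sub_mul, mul_sub, one_mul, mul_one, smul_mul_assoc, mul_smul_comm, smul_sub, star_sub,
      star_one, smul_smul]
    module
  have hmid : (1 - z) • X + star (1 - z) • Y -
      ((1 - z) * star (1 - z)) • (X * (C.conjTranspose * J * C) * Y) =
      (1 - z * star z) • (Rz * Q * Rz.conjTranspose) := by
    have h1 : ∀ (c₁ c₂ c₃ : R) (M₁ M₂ M₃ : Matrix n n R),
        X * (c₁ • M₁ + c₂ • M₂ - c₃ • M₃) * Y =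
          c₁ • (X * M₁ * Y) + c₂ • (X * M₂ * Y) - c₃ • (X * M₃ * Y) := fun c₁ c₂ c₃ M₁ M₂ M₃ => by
      simp only [mul_sub, mul_add, sub_mul, add_mul, mul_smul_comm, smul_mul_assoc]
    have h2 := h1 (1 - z) (star (1 - z)) ((1 - z) * star (1 - z))
      ((1 - z • A).conjTranspose * P * (1 - A)) ((1 - A).conjTranspose * P * (1 - z • A))
      (P - A.conjTranspose * P * A)
    rw [hbr, e1, e2, hst, mul_smul_comm, smul_mul_assoc, e3] at h2
    exact h2.symm
  have hJc : ∀ M : Matrix m m R, J * (J * M) = M := fun M => by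
    rw [← Matrix.mul_assoc, hJ, Matrix.one_mul]
  have hT : C * Rz * Q * S.conjTranspose * (C.conjTranspose * J) =
      C * (X * (C.conjTranspose * J)) := by
    simp only [hX, Matrix.mul_assoc]
  have hTH : (C * (X * (C.conjTranspose * J))).conjTranspose =
      J * (C * (Y * C.conjTranspose)) := by
    simp only [Matrix.conjTranspose_mul, hXY, hJH, Matrix.conjTranspose_conjTranspose,
      Matrix.mul_assoc]
  have hfin : C * Rz * Q * (C * Rz).conjTranspose =
      C * (Rz * Q * Rz.conjTranspose * C.conjTranspose) := by
    simp only [Matrix.conjTranspose_mul, Matrix.mul_assoc]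
  have hgoal : (1 - z * star z) • (C * (Rz * Q * Rz.conjTranspose * C.conjTranspose)) =
      C * (((1 - z) • X + star (1 - z) • Y -
        ((1 - z) * star (1 - z)) • (X * (C.conjTranspose * J * C) * Y)) * C.conjTranspose) := by
    rw [hmid, Matrix.smul_mul, Matrix.mul_smul]
  rw [hfin, hgoal, hT, Matrix.conjTranspose_sub,
    Matrix.conjTranspose_one, Matrix.conjTranspose_smul, hTH]
  simp only [Matrix.sub_mul, Matrix.mul_sub, Matrix.add_mul, Matrix.mul_add, Matrix.one_mul,
    Matrix.mul_one, Matrix.smul_mul, Matrix.mul_smul, Matrix.mul_assoc, hJc, hJ]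
  module

/-! ### The matrix function `Θ` over `𝔑` -/

theorem norm_E_lt_one {r : N} (h : r ∈ NDisk) : ‖E r‖ < 1 := mem_ball_zero_iff.1 h

theorem one_sub_mul_star_ne_zero {z w : ℂ} (hz : ‖z‖ < 1) (hw : ‖w‖ < 1) :
    1 - z * star w ≠ 0 := by
  intro h0
  have h1 : ‖z * star w‖ < 1 := by
    rw [norm_mul, norm_star]
    nlinarith [norm_nonneg z, norm_nonneg w]
  rw [← sub_eq_zero.1 h0, norm_one] at h1
  exact lt_irrefl _ h1

theorem E_ringInverse {r : N} (h : IsUnit r) : E r⁻¹ʳ = (E r)⁻¹ := by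
  refine eq_inv_of_mul_eq_one_left ?_
  rw [← map_mul, Ring.inverse_mul_cancel _ h, map_one]

theorem isUnit_one_sub_mul_star {r s : N} (hr : r ∈ NDisk) (hs : s ∈ NDisk) :
    IsUnit (1 - r * star s) := by
  refine isUnit_of_E_ne_zero ?_
  rw [map_sub, map_one, map_mul, E_star]
  exact one_sub_mul_star_ne_zero (norm_E_lt_one hr) (norm_E_lt_one hs)

theorem algebraMap_mem_NDisk (z : Disk) : algebraMap ℂ N z ∈ NDisk := by
  change E (algebraMap ℂ N z) ∈ Metric.ball (0 : ℂ) 1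
  rw [E_algebraMap]
  exact z.2

section

variable {n : ℕ} {a b : Fin n → N}

/-- The matrix `(I - λ A)⁻¹`, for `λ ∈ 𝔑`. -/
def resolvent (a : Fin n → N) (z : N) : Matrix (Fin n) (Fin n) N :=
  Matrix.diagonal fun j => (1 - z * star (a j))⁻¹ʳ

theorem one_sub_smul_matA (a : Fin n → N) (z : N) :
    1 - z • matA a = Matrix.diagonal fun j => 1 - z * star (a j) := by
  rw [matA, ← Matrix.diagonal_smul, ← Matrix.diagonal_one, Matrix.diagonal_sub]
  rfl

theorem mul_resolvent {z : N} (h : ∀ j, IsUnit (1 - z * star (a j))) :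
    (1 - z • matA a) * resolvent a z = 1 := by
  rw [one_sub_smul_matA, resolvent, Matrix.diagonal_mul_diagonal, ← Matrix.diagonal_one]
  congr 1
  ext1 j
  exact Ring.mul_inverse_cancel _ (h j)

theorem algebraMap_smul_matA (a : Fin n → N) (z : ℂ) :
    z • matA a = algebraMap ℂ N z • matA a := (algebraMap_smul N z (matA a)).symm

theorem mul_resolvent_disk (ha : ∀ i, a i ∈ NDisk) (z : Disk) :
    (1 - algebraMap ℂ N z • matA a) * resolvent a (algebraMap ℂ N z) = 1 :=
  mul_resolvent fun j => isUnit_one_sub_mul_star (algebraMap_mem_NDisk z) (ha j)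

theorem mul_resolvent_one (ha : ∀ i, a i ∈ NDisk) : (1 - matA a) * resolvent a 1 = 1 := by
  have h := mul_resolvent (a := a) (z := 1) fun j => by
    refine isUnit_of_E_ne_zero ?_
    rw [one_mul, map_sub, map_one, E_star, sub_ne_zero]
    intro h1
    have h2 := norm_E_lt_one (ha j)
    rw [← norm_star, ← h1, norm_one] at h2
    exact lt_irrefl _ h2
  rwa [one_smul] at h

theorem conjTranspose_matA (a : Fin n → N) : (matA a).conjTranspose = Matrix.diagonal a := by
  rw [matA, Matrix.diagonal_conjTranspose]
  congr 1
  ext1 j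
  exact star_star _

theorem StrictlyPositive.isUnit {M : Matrix (Fin n) (Fin n) N} (h : StrictlyPositive M) :
    IsUnit M := by
  obtain ⟨G, hG, rfl⟩ := h
  exact hG.mul hG.star

theorem StrictlyPositive.mul_inv {M : Matrix (Fin n) (Fin n) N} (h : StrictlyPositive M) :
    M * M⁻¹ = 1 := Matrix.mul_nonsing_inv _ ((Matrix.isUnit_iff_isUnit_det _).1 h.isUnit)

theorem StrictlyPositive.conjTranspose_eq {M : Matrix (Fin n) (Fin n) N}
    (h : StrictlyPositive M) : M.conjTranspose = M := by
  obtain ⟨G, -, rfl⟩ := h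
  rw [Matrix.conjTranspose_mul, Matrix.conjTranspose_conjTranspose]

open scoped ComplexOrder in
theorem StrictlyPositive.posDef_map {M : Matrix (Fin n) (Fin n) N} (h : StrictlyPositive M) :
    (M.map E).PosDef := by
  obtain ⟨G, hG, rfl⟩ := h
  have h1 : (G * G.conjTranspose).map E = G.map E * (G.map E).conjTranspose := by
    rw [Matrix.map_mul]
    congr 1
  rw [h1]
  refine Matrix.PosDef.mul_conjTranspose_self _ (Matrix.vecMul_injective_of_isUnit ?_)
  exact hG.map E.mapMatrix

theorem conjTranspose_matJ : matJ.conjTranspose = matJ := by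
  ext i j
  fin_cases i <;> fin_cases j <;> simp [matJ]

theorem matJ_mul_matJ : matJ * matJ = 1 := by
  ext i j
  fin_cases i <;> fin_cases j <;> simp [matJ, Matrix.mul_apply]

theorem conjTranspose_matC_mul_matJ_apply (i : Fin n) (M : Matrix (Fin 2) (Fin 2) N) (l : Fin 2) :
    ((matC b).conjTranspose * matJ * M) i l = M 0 l - b i * M 1 l := by
  simp [Matrix.mul_apply, Fin.sum_univ_two, matC, matJ, Matrix.conjTranspose_apply]
  ring

theorem pick_stein (ha : ∀ i, a i ∈ NDisk) :
    pick a b - (matA a).conjTranspose * pick a b * matA a =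
      (matC b).conjTranspose * matJ * matC b := by
  ext i j
  have h1 : pick a b i j * (1 - a i * star (a j)) = 1 - b i * star (b j) := by
    rw [pick, Matrix.of_apply, mul_assoc,
      Ring.inverse_mul_cancel _ (isUnit_one_sub_mul_star (ha i) (ha j)), mul_one]
  have h2 : ((matC b).conjTranspose * matJ * matC b) i j = 1 - b i * star (b j) := by
    simp [Matrix.mul_apply, Fin.sum_univ_two, matC, matJ, Matrix.conjTranspose_apply]
    ring
  rw [h2, ← h1, Matrix.sub_apply, conjTranspose_matA, matA, Matrix.mul_diagonal,
    Matrix.diagonal_mul]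
  ring_nf

theorem theta_eq (ha : ∀ i, a i ∈ NDisk) (z : Disk) :
    theta a b z = 1 - (1 - algebraMap ℂ N z) • (matC b * resolvent a (algebraMap ℂ N z) *
      (pick a b)⁻¹ * (resolvent a 1).conjTranspose * ((matC b).conjTranspose * matJ)) := by
  have h1 : ((1 - matA a).conjTranspose)⁻¹ = (resolvent a 1).conjTranspose := by
    refine Matrix.inv_eq_left_inv ?_
    rw [← Matrix.conjTranspose_mul, mul_resolvent_one ha, Matrix.conjTranspose_one]
  rw [theta, h1, algebraMap_smul_matA, Matrix.inv_eq_right_inv (mul_resolvent_disk ha z),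
    ← Matrix.mul_assoc _ (matC b).conjTranspose matJ, ← algebraMap_smul N (1 - (z : ℂ)), map_sub,
    map_one]

theorem anAt_resolvent (ha : ∀ i, a i ∈ NDisk) (j : Fin n) (ζ₀ : Disk) :
    AnAt (fun ζ => (1 - algebraMap ℂ N ζ * star (a j))⁻¹ʳ) ζ₀ :=
  ((AnAt.const 1).sub (AnAt.coord.mul (AnAt.const _))).inverse
    (isUnit_one_sub_mul_star (algebraMap_mem_NDisk ζ₀) (ha j))

/-- A matrix product of the form `M (I - λ A)⁻¹ K` depends analytically on `λ`. -/
theorem anAt_mul_resolvent_mul (ha : ∀ i, a i ∈ NDisk) {p q : Type*}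
    (M : Matrix p (Fin n) N) (K : Matrix (Fin n) q N) (i : p) (l : q) (ζ₀ : Disk) :
    AnAt (fun ζ => (M * resolvent a (algebraMap ℂ N ζ) * K) i l) ζ₀ := by
  have h : ∀ ζ : Disk, (M * resolvent a (algebraMap ℂ N ζ) * K) i l =
      ∑ j, M i j * (1 - algebraMap ℂ N ζ * star (a j))⁻¹ʳ * K j l := fun ζ => by
    rw [resolvent, Matrix.mul_apply]
    exact Finset.sum_congr rfl fun j _ => by rw [Matrix.mul_diagonal]
  simp only [h]
  exact AnAt.sum _ fun j _ => ((AnAt.const _).mul (anAt_resolvent ha j ζ₀)).mul (AnAt.const _)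

theorem anAt_theta (ha : ∀ i, a i ∈ NDisk) (k l : Fin 2) (ζ₀ : Disk) :
    AnAt (fun ζ => theta a b ζ k l) ζ₀ := by
  have h1 : ∀ ζ : Disk, theta a b ζ k l = (1 : Matrix (Fin 2) (Fin 2) N) k l -
      (1 - algebraMap ℂ N ζ) * (matC b * resolvent a (algebraMap ℂ N ζ) *
        ((pick a b)⁻¹ * ((resolvent a 1).conjTranspose * ((matC b).conjTranspose * matJ)))) k l := by
    intro ζ
    rw [theta_eq ha, Matrix.sub_apply, Matrix.smul_apply, smul_eq_mul]
    simp only [Matrix.mul_assoc]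
  simp only [h1]
  exact (AnAt.const _).sub (((AnAt.const 1).sub AnAt.coord).mul
    (anAt_mul_resolvent_mul ha _ _ k l ζ₀))

theorem one_sub_conjTranspose_mul (ha : ∀ i, a i ∈ NDisk) :
    (1 - (matA a).conjTranspose) * (resolvent a 1).conjTranspose = 1 := by
  have h : (resolvent a 1 * (1 - matA a)).conjTranspose = 1 := by
    rw [mul_eq_one_comm.1 (mul_resolvent_one ha), Matrix.conjTranspose_one]
  rwa [Matrix.conjTranspose_mul, Matrix.conjTranspose_sub, Matrix.conjTranspose_one] at h

theorem smul_one_sub_conjTranspose (a : Fin n → N) (z : N) :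
    z • 1 - (matA a).conjTranspose = Matrix.diagonal fun i => z - a i := by
  rw [conjTranspose_matA, ← Matrix.diagonal_one, ← Matrix.diagonal_smul, Matrix.diagonal_sub]
  congr 1
  ext1 i
  simp

/-- The row `(1, -b_i) Θ` vanishes at `a_i`. -/
theorem exists_theta_dvd (ha : ∀ i, a i ∈ NDisk) (hP : StrictlyPositive (pick a b)) (i : Fin n)
    (l : Fin 2) : ∃ h : Disk → N, (∀ ζ₀, AnAt h ζ₀) ∧
      ∀ ζ : Disk, theta a b ζ 0 l - b i * theta a b ζ 1 l = (algebraMap ℂ N ζ - a i) * h ζ := by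
  refine ⟨fun ζ => (pick a b * (1 - matA a) * resolvent a (algebraMap ℂ N ζ) * ((pick a b)⁻¹ *
    ((resolvent a 1).conjTranspose * ((matC b).conjTranspose * matJ))) :
    Matrix (Fin n) (Fin 2) N) i l,
    fun ζ₀ => anAt_mul_resolvent_mul ha _ _ i l ζ₀, fun ζ => ?_⟩
  have h1 := mul_thetaForm (pick_stein (b := b) ha) (mul_resolvent_disk ha ζ) hP.mul_inv
    (one_sub_conjTranspose_mul ha)
  rw [← theta_eq ha, smul_one_sub_conjTranspose] at h1
  have h2 := congrFun (congrFun h1 i) l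
  rw [conjTranspose_matC_mul_matJ_apply] at h2
  rw [h2]
  simp only [Matrix.mul_assoc]
  rw [Matrix.diagonal_mul]

/-- The determinant of `Θ` is `∏ (λ - a_i)`, up to an invertible factor. -/
theorem exists_theta_det (ha : ∀ i, a i ∈ NDisk) (hP : StrictlyPositive (pick a b)) :
    ∃ κ : Disk → N, (∀ ζ₀, AnAt κ ζ₀) ∧ (∀ ζ, IsUnit (κ ζ)) ∧
      ∀ ζ : Disk, theta a b ζ 0 0 * theta a b ζ 1 1 - theta a b ζ 0 1 * theta a b ζ 1 0 =
        (∏ i, (algebraMap ℂ N ζ - a i)) * κ ζ := by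
  refine ⟨fun ζ => (1 - matA a).det * (resolvent a (algebraMap ℂ N ζ)).det *
    ((resolvent a 1).conjTranspose).det, fun ζ₀ => ?_, fun ζ => ?_, fun ζ => ?_⟩
  · refine ((AnAt.const _).mul ?_).mul (AnAt.const _)
    simp only [resolvent, Matrix.det_diagonal]
    exact AnAt.prod _ fun j _ => anAt_resolvent ha j ζ₀
  · have h1 := congrArg Matrix.det (mul_resolvent_disk ha ζ)
    have h2 := congrArg Matrix.det (mul_resolvent_one ha)
    have h3 := congrArg Matrix.det (one_sub_conjTranspose_mul ha)
    rw [Matrix.det_mul, Matrix.det_one] at h1 h2 h3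
    exact ((IsUnit.of_mul_eq_one _ h2).mul (IsUnit.of_mul_eq_one_right _ h1)).mul
      (IsUnit.of_mul_eq_one_right _ h3)
  · have h1 := det_thetaForm (pick_stein (b := b) ha) (mul_resolvent_disk ha ζ) hP.mul_inv
      (one_sub_conjTranspose_mul ha)
    rw [← theta_eq ha, smul_one_sub_conjTranspose, Matrix.det_diagonal, Matrix.det_fin_two] at h1
    exact h1

/-- The identity `J - Θ J Θ* = (1 - |λ|²) C (I - λ A)⁻¹ P⁻¹ (I - λ A)^{-*} C*` for the constant
coefficients, evaluated at a row vector `x`. -/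
theorem theta_form (ha : ∀ i, a i ∈ NDisk) (hP : StrictlyPositive (pick a b)) (z : Disk)
    (x : Fin 2 → ℂ) {y : Fin n → ℂ}
    (hy : ∀ j, y j = (x 0 + x 1 * star (E (b j))) * (1 - z * star (E (a j)))⁻¹) :
    ‖x 0‖ ^ 2 - ‖x 1‖ ^ 2 -
      (‖x 0 * E (theta a b z 0 0) + x 1 * E (theta a b z 1 0)‖ ^ 2 -
        ‖x 0 * E (theta a b z 0 1) + x 1 * E (theta a b z 1 1)‖ ^ 2) =
      (1 - ‖(z : ℂ)‖ ^ 2) * (y ⬝ᵥ Matrix.mulVec ((pick a b)⁻¹.map E) (star y)).re := by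
  have h1 := thetaForm_mul_conjTranspose (pick_stein (b := b) ha) (mul_resolvent_disk ha z)
    hP.mul_inv (mul_resolvent_one ha) hP.conjTranspose_eq conjTranspose_matJ matJ_mul_matJ
  rw [← theta_eq ha] at h1
  generalize theta a b z = Θ at h1 ⊢
  set F := matC b * resolvent a (algebraMap ℂ N z) with hF
  have hyF : y = Matrix.vecMul x (F.map E) := by
    ext1 j
    have h0 : IsUnit (1 - algebraMap ℂ N z * star (a j)) :=
      isUnit_one_sub_mul_star (algebraMap_mem_NDisk z) (ha j)
    have h2 : ∀ k, E (F k j) = E (matC b k j) * (1 - (z : ℂ) * star (E (a j)))⁻¹ := fun k => by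
      rw [hF, resolvent, Matrix.mul_diagonal, map_mul, E_ringInverse h0, map_sub, map_one,
        map_mul, E_algebraMap, E_star]
    have h3 : E (matC b 0 j) = 1 := map_one E
    have h4 : E (matC b 1 j) = star (E (b j)) := E_star (b j)
    simp only [Matrix.vecMul, dotProduct, Fin.sum_univ_two, Matrix.map_apply, h2, h3, h4, hy]
    ring
  clear_value F
  have hconj : (F.map E).conjTranspose = F.conjTranspose.map E := by
    ext i j
    exact (E_star _).symm
  have hform : y ⬝ᵥ Matrix.mulVec ((pick a b)⁻¹.map E) (star y) =
      x ⬝ᵥ Matrix.mulVec ((F * (pick a b)⁻¹ * F.conjTranspose).map E) (star x) := by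
    rw [hyF, Matrix.star_vecMul, Matrix.mulVec_mulVec, ← Matrix.dotProduct_mulVec,
      Matrix.mulVec_mulVec, hconj, Matrix.map_mul, Matrix.map_mul, Matrix.mul_assoc]
  have hentry : ∀ k l, E ((F * (pick a b)⁻¹ * F.conjTranspose) k l) * (1 - (z : ℂ) * star (z : ℂ)) =
      E (matJ k l) - (E (Θ k 0) * star (E (Θ l 0)) - E (Θ k 1) * star (E (Θ l 1))) := by
    intro k l
    have h2 := congrArg E (congrFun (congrFun h1 k) l)
    have h3 : (Θ * matJ * Θ.conjTranspose) k l =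
        Θ k 0 * star (Θ l 0) - Θ k 1 * star (Θ l 1) := by
      simp [Matrix.mul_apply, Fin.sum_univ_two, matJ, Matrix.conjTranspose_apply]
      ring
    rw [Matrix.sub_apply, h3, Matrix.smul_apply, smul_eq_mul] at h2
    simp only [map_sub, map_mul, map_one, E_star, E_algebraMap] at h2
    rw [h2, mul_comm]
  have hsq : ∀ w : ℂ, ‖w‖ ^ 2 = (w * star w).re := fun w => by
    rw [Complex.star_def, Complex.mul_conj, Complex.normSq_eq_norm_sq, Complex.ofReal_re]
  have hz : (1 - ‖(z : ℂ)‖ ^ 2 : ℝ) = ((1 : ℂ) - z * star (z : ℂ)) := by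
    rw [Complex.star_def, Complex.mul_conj, Complex.normSq_eq_norm_sq]
    push_cast
    rfl
  rw [hform, ← Complex.re_ofReal_mul, hz]
  simp only [hsq, ← Complex.sub_re]
  congr 1
  have hJ : E (matJ 0 0) = 1 ∧ E (matJ 0 1) = 0 ∧ E (matJ 1 0) = 0 ∧ E (matJ 1 1) = -1 :=
    ⟨map_one E, map_zero E, map_zero E, by rw [← map_one E, ← map_neg]; rfl⟩
  have e00 := hentry 0 0
  have e01 := hentry 0 1
  have e10 := hentry 1 0
  have e11 := hentry 1 1
  rw [hJ.1] at e00
  rw [hJ.2.1] at e01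
  rw [hJ.2.2.1] at e10
  rw [hJ.2.2.2] at e11
  simp only [dotProduct, Matrix.mulVec, Fin.sum_univ_two, Matrix.map_apply, Pi.star_apply,
    star_add, star_mul']
  linear_combination (-x 0 * star (x 0)) * e00 - (x 0 * star (x 1)) * e01 -
    (x 1 * star (x 0)) * e10 - (x 1 * star (x 1)) * e11

end

/-! ### Division of analytic functions by `∏ (λ - a_i)` -/

theorem isUnit_algebraMap_sub_iff {z : ℂ} {r : N} :
    IsUnit (algebraMap ℂ N z - r) ↔ z ≠ E r := by
  rw [isUnit_iff_E_ne_zero, map_sub, E_algebraMap, sub_ne_zero]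

theorem eventually_isUnit_sub (r : N) (ζ₀ : Disk) :
    ∀ᶠ ζ : Disk in 𝓝 ζ₀, ζ ≠ ζ₀ → IsUnit (algebraMap ℂ N ζ - r) := by
  simp only [isUnit_algebraMap_sub_iff]
  by_cases h : (ζ₀ : ℂ) = E r
  · exact Filter.Eventually.of_forall fun ζ hζ h1 => hζ (Subtype.ext (h1.trans h.symm))
  · exact (continuous_subtype_val.continuousAt.eventually_ne h).mono fun ζ h1 _ => h1

/-- The product `∏ (λ - a_i)`, whose classical counterpart vanishes at the nodes. -/
def nodal {n : ℕ} (a : Fin n → N) (ζ : Disk) : N := ∏ i, (algebraMap ℂ N ζ - a i)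

theorem eventually_isUnit_nodal {n : ℕ} (a : Fin n → N) (ζ₀ : Disk) :
    ∀ᶠ ζ in 𝓝 ζ₀, ζ ≠ ζ₀ → IsUnit (nodal a ζ) := by
  filter_upwards [Filter.eventually_all.2 fun i => eventually_isUnit_sub (a i) ζ₀] with ζ h hne
  exact Finset.prod_induction _ IsUnit (fun _ _ => IsUnit.mul) isUnit_one fun i _ => h i hne

theorem eq_of_nodal_mul_eq {n : ℕ} (a : Fin n → N) {f g : Disk → N} {ζ₀ : Disk}
    (hf : AnAt f ζ₀) (hg : AnAt g ζ₀) (h : ∀ ζ, nodal a ζ * f ζ = nodal a ζ * g ζ) :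
    f ζ₀ = g ζ₀ :=
  hf.eq_of_eventually_ne hg ((eventually_isUnit_nodal a ζ₀).mono fun ζ hu hne =>
    (hu hne).mul_left_cancel (h ζ))

/-- Local divisibility implies divisibility, because the quotients are unique off the nodes. -/
theorem exists_eq_nodal_mul_of_local {n : ℕ} (a : Fin n → N) {f : Disk → N}
    (h : ∀ ζ₀, ∃ w, AnAt w ζ₀ ∧ ∀ᶠ ζ in 𝓝 ζ₀, f ζ = nodal a ζ * w ζ) :
    ∃ u : Disk → N, (∀ ζ₀, AnAt u ζ₀) ∧ ∀ ζ, f ζ = nodal a ζ * u ζ := by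
  choose w hw hfw using h
  refine ⟨fun ζ => w ζ ζ, fun ζ₀ => (hw ζ₀).congr ?_, fun ζ => (hfw ζ).self_of_nhds⟩
  filter_upwards [hfw ζ₀, eventually_isUnit_nodal a ζ₀] with ζ h1 h2
  by_cases hne : ζ = ζ₀
  · rw [hne]
  · exact (h2 hne).mul_left_cancel (h1.symm.trans (hfw ζ).self_of_nhds)

theorem exists_eq_nodal_mul {n : ℕ} {a : Fin n → N} (ha : ∀ i, a i ∈ NDisk)
    (hinj : ∀ i j, E (a i) = E (a j) → i = j) {f : Disk → N} (hf : ∀ ζ₀, AnAt f ζ₀)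
    (hdvd : ∀ i, ∃ g : Disk → N, AnAt g ⟨E (a i), ha i⟩ ∧
      ∀ᶠ ζ in 𝓝 (⟨E (a i), ha i⟩ : Disk), f ζ = (algebraMap ℂ N ζ - a i) * g ζ) :
    ∃ u : Disk → N, (∀ ζ₀, AnAt u ζ₀) ∧ ∀ ζ, f ζ = nodal a ζ * u ζ := by
  classical
  refine exists_eq_nodal_mul_of_local a fun ζ₀ => ?_
  -- The part `s` of the product which is invertible at `ζ₀` is divided out.
  have key : ∀ s : Finset (Fin n), (∀ i ∈ s, (ζ₀ : ℂ) ≠ E (a i)) → ∃ q : Disk → N, AnAt q ζ₀ ∧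
      ∀ᶠ ζ : Disk in 𝓝 ζ₀, (∏ i ∈ s, (algebraMap ℂ N ζ - a i)) * q ζ = 1 := by
    intro s hs
    have han : AnAt (fun ζ => ∏ i ∈ s, (algebraMap ℂ N ζ - a i)) ζ₀ :=
      AnAt.prod _ fun _ _ => AnAt.coord.sub (AnAt.const _)
    refine ⟨_, han.inverse (Finset.prod_induction _ IsUnit (fun _ _ => IsUnit.mul) isUnit_one
      fun i hi => isUnit_algebraMap_sub_iff.2 (hs i hi)), ?_⟩
    have hev : ∀ᶠ ζ : Disk in 𝓝 ζ₀, ∀ i, i ∈ s → (ζ : ℂ) ≠ E (a i) :=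
      Filter.eventually_all.2 fun i => by
        by_cases hi : i ∈ s
        · exact (continuous_subtype_val.continuousAt.eventually_ne (hs i hi)).mono fun _ h _ => h
        · exact Filter.Eventually.of_forall fun _ h => absurd h hi
    filter_upwards [hev] with ζ hζ
    exact Ring.mul_inverse_cancel _ (Finset.prod_induction _ IsUnit (fun _ _ => IsUnit.mul)
      isUnit_one fun i hi => isUnit_algebraMap_sub_iff.2 (hζ i hi))
  by_cases h : ∃ i, (ζ₀ : ℂ) = E (a i)
  · obtain ⟨i, hi⟩ := h
    obtain ⟨q, hq, hq1⟩ := key (Finset.univ.erase i) fun j hj h1 =>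
      (Finset.mem_erase.1 hj).1 (hinj j i (h1.symm.trans hi))
    obtain ⟨g, hg, hfg⟩ := hdvd i
    have hζ₀ : (⟨E (a i), ha i⟩ : Disk) = ζ₀ := Subtype.ext hi.symm
    rw [hζ₀] at hg hfg
    refine ⟨fun ζ => g ζ * q ζ, hg.mul hq, ?_⟩
    filter_upwards [hq1, hfg] with ζ h1 h2
    rw [nodal, ← Finset.mul_prod_erase _ _ (Finset.mem_univ i), h2]
    linear_combination (-(algebraMap ℂ N ζ - a i) * g ζ) * h1
  · obtain ⟨q, hq, hq1⟩ := key Finset.univ fun i _ h1 => h ⟨i, h1⟩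
    refine ⟨fun ζ => f ζ * q ζ, (hf ζ₀).mul hq, ?_⟩
    filter_upwards [hq1] with ζ h1
    rw [nodal]
    linear_combination (-f ζ) * h1

theorem AnAt.norm_E_le_of_eventually_ne {f g : Disk → N} {ζ₀ : Disk} (hf : AnAt f ζ₀)
    (hg : AnAt g ζ₀) (h : ∀ᶠ ζ in 𝓝 ζ₀, ζ ≠ ζ₀ → ‖E (f ζ)‖ ≤ ‖E (g ζ)‖) :
    ‖E (f ζ₀)‖ ≤ ‖E (g ζ₀)‖ := by
  obtain ⟨φ, hφ, hf⟩ := hf.exists_analyticAt_E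
  obtain ⟨ψ, hψ, hg⟩ := hg.exists_analyticAt_E
  have h1 : ∀ᶠ z : ℂ in 𝓝 (ζ₀ : ℂ), z ≠ ζ₀ → ‖φ z‖ ≤ ‖ψ z‖ := by
    refine eventually_disk_iff.1 ?_
    filter_upwards [h, hf, hg] with ζ h2 h3 h4 hne
    rw [← h3, ← h4]
    exact h2 fun h5 => hne (congrArg _ h5)
  rw [hf.self_of_nhds, hg.self_of_nhds]
  exact le_of_tendsto_of_tendsto
    (hφ.continuousAt.norm.continuousWithinAt (s := {(ζ₀ : ℂ)}ᶜ))
    (hψ.continuousAt.norm.continuousWithinAt (s := {(ζ₀ : ℂ)}ᶜ))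
    (eventually_nhdsWithin_iff.2 h1)

/-! ### Consequences of the positivity of the Pick matrix -/

section

variable {n : ℕ} {a b : Fin n → N}

theorem E_pick (ha : ∀ i, a i ∈ NDisk) (i j : Fin n) : E (pick a b i j) =
    (1 - E (b i) * star (E (b j))) * (1 - E (a i) * star (E (a j)))⁻¹ := by
  rw [pick, Matrix.of_apply, map_mul, E_ringInverse (isUnit_one_sub_mul_star (ha i) (ha j))]
  simp only [map_sub, map_mul, map_one, E_star]

theorem map_pick_mul_map_inv (hP : StrictlyPositive (pick a b)) :
    (pick a b).map E * (pick a b)⁻¹.map E = 1 := by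
  rw [← Matrix.map_mul, hP.mul_inv, Matrix.map_one _ (map_zero E) (map_one E)]

/-- If two nodes had the same constant coefficient, the corresponding `2 × 2` minor of the Pick
matrix of the constant coefficients would not be positive. -/
theorem E_injective_of_strictlyPositive (ha : ∀ i, a i ∈ NDisk)
    (hP : StrictlyPositive (pick a b)) (i j : Fin n) (hij : E (a i) = E (a j)) : i = j := by
  by_contra hne
  have hv : (Pi.single i 1 - Pi.single j 1 : Fin n → ℂ) ≠ 0 := fun h => by
    have := congrFun h i
    simp [hne] at this
  have h1 := hP.posDef_map.re_dotProduct_pos hv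
  have h2 : star (Pi.single i 1 - Pi.single j 1 : Fin n → ℂ) ⬝ᵥ
      Matrix.mulVec ((pick a b).map E) (Pi.single i 1 - Pi.single j 1) =
      E (pick a b i i) - E (pick a b i j) - E (pick a b j i) + E (pick a b j j) := by
    simp [Matrix.mulVec_sub, sub_dotProduct, dotProduct_sub]
    ring
  have h3 : 0 < 1 - ‖E (a j)‖ ^ 2 := by
    have := norm_E_lt_one (ha j)
    nlinarith [norm_nonneg (E (a j))]
  have h4 : (1 - E (a j) * star (E (a j)))⁻¹ = (((1 - ‖E (a j)‖ ^ 2)⁻¹ : ℝ) : ℂ) := by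
    rw [Complex.star_def, Complex.mul_conj, Complex.normSq_eq_norm_sq]
    push_cast
    rfl
  rw [h2] at h1
  simp only [E_pick ha, hij, h4] at h1
  have h5 : ∀ (β γ : ℂ) (c : ℝ), ((1 - β * star β) * (c : ℂ) - (1 - β * star γ) * (c : ℂ) -
      (1 - γ * star β) * (c : ℂ) + (1 - γ * star γ) * (c : ℂ)).re =
      -(Complex.normSq (β - γ) * c) := by
    intro β γ c
    simp [Complex.normSq_apply]
    ring
  rw [RCLike.re_eq_complex_re, h5] at h1
  have h6 := mul_nonneg (Complex.normSq_nonneg (E (b i) - E (b j))) (inv_nonneg.2 h3.le)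
  linarith

open scoped ComplexOrder in
theorem theta_form_nonneg (ha : ∀ i, a i ∈ NDisk) (hP : StrictlyPositive (pick a b)) (z : Disk)
    (x : Fin 2 → ℂ) :
    ‖x 0 * E (theta a b z 0 0) + x 1 * E (theta a b z 1 0)‖ ^ 2 -
      ‖x 0 * E (theta a b z 0 1) + x 1 * E (theta a b z 1 1)‖ ^ 2 ≤ ‖x 0‖ ^ 2 - ‖x 1‖ ^ 2 := by
  have h1 := theta_form ha hP z x (fun j => rfl)
  have hz : 0 ≤ 1 - ‖(z : ℂ)‖ ^ 2 := by
    have := mem_ball_zero_iff.1 z.2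
    nlinarith [norm_nonneg (z : ℂ)]
  have hQ : ((pick a b)⁻¹.map E).PosSemidef := by
    rw [← Matrix.inv_eq_right_inv (map_pick_mul_map_inv hP)]
    exact hP.posDef_map.inv.posSemidef
  have h2 := fun y : Fin n → ℂ => hQ.re_dotProduct_nonneg (star y)
  simp only [star_star] at h2
  have h3 := mul_nonneg hz (h2 fun j =>
    (x 0 + x 1 * star (E (b j))) * (1 - z * star (E (a j)))⁻¹)
  change 0 ≤ _ * Complex.re _ at h3
  rw [← h1] at h3
  linarith

theorem isUnit_denom (ha : ∀ i, a i ∈ NDisk) (hP : StrictlyPositive (pick a b)) {g : Disk → N}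
    (hg : g ∈ schur) (z : Disk) : IsUnit (denom a b g z) := by
  refine isUnit_of_E_ne_zero fun h0 => ?_
  have h1 := theta_form_nonneg ha hP z ![0, 1]
  simp only [Matrix.cons_val_zero, Matrix.cons_val_one, zero_mul, one_mul, zero_add, norm_zero,
    norm_one] at h1
  rw [denom, map_add, map_mul] at h0
  have h2 : ‖E (theta a b z 1 1)‖ ≤ ‖E (theta a b z 1 0)‖ := by
    rw [eq_neg_of_add_eq_zero_right h0, norm_neg, norm_mul]
    exact mul_le_of_le_one_right (norm_nonneg _) (hg.2 z)
  nlinarith [norm_nonneg (E (theta a b z 1 1))]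

theorem linFrac_mul_denom (ha : ∀ i, a i ∈ NDisk) (hP : StrictlyPositive (pick a b))
    {g : Disk → N} (hg : g ∈ schur) (z : Disk) :
    linFrac a b g z * denom a b g z = theta a b z 0 0 * g z + theta a b z 0 1 := by
  rw [linFrac, mul_assoc, Ring.inverse_mul_cancel _ (isUnit_denom ha hP hg z), mul_one]

theorem anAt_denom (ha : ∀ i, a i ∈ NDisk) {g : Disk → N} (hg : g ∈ schur) (ζ₀ : Disk) :
    AnAt (denom a b g) ζ₀ :=
  ((anAt_theta ha 1 0 ζ₀).mul (isAnalytic_iff.1 hg.1 ζ₀)).add (anAt_theta ha 1 1 ζ₀)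

theorem anAt_linFrac (ha : ∀ i, a i ∈ NDisk) (hP : StrictlyPositive (pick a b))
    {g : Disk → N} (hg : g ∈ schur) (ζ₀ : Disk) : AnAt (linFrac a b g) ζ₀ :=
  (((anAt_theta ha 0 0 ζ₀).mul (isAnalytic_iff.1 hg.1 ζ₀)).add (anAt_theta ha 0 1 ζ₀)).mul
    ((anAt_denom ha hg ζ₀).inverse (isUnit_denom ha hP hg ζ₀))

/-- With `f = T_Θ(g)`, the row `(1, -f) Θ` is a multiple of `(1, -g)`; the `J`-contractivity of `Θ`
on this row then gives `|g| ≤ 1 → |f| ≤ 1` for the constant coefficients. -/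
theorem linFrac_mem_schur (ha : ∀ i, a i ∈ NDisk) (hP : StrictlyPositive (pick a b))
    {g : Disk → N} (hg : g ∈ schur) : linFrac a b g ∈ schur := by
  refine ⟨isAnalytic_iff.2 (anAt_linFrac ha hP hg), fun z => ?_⟩
  have h1 := theta_form_nonneg ha hP z ![1, -E (linFrac a b g z)]
  have h2 := congrArg E (linFrac_mul_denom ha hP hg z)
  simp only [Matrix.cons_val_zero, Matrix.cons_val_one, one_mul, norm_one, norm_neg] at h1
  rw [denom] at h2
  simp only [map_add, map_mul] at h2
  generalize E (linFrac a b g z) = f at h1 h2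
  have h3 : E (theta a b z 0 1) + -f * E (theta a b z 1 1) =
      -((E (theta a b z 0 0) + -f * E (theta a b z 1 0)) * E (g z)) := by
    linear_combination -h2
  have h4 : ‖E (theta a b z 0 1) + -f * E (theta a b z 1 1)‖ ≤
      ‖E (theta a b z 0 0) + -f * E (theta a b z 1 0)‖ := by
    rw [h3, norm_neg, norm_mul]
    exact mul_le_of_le_one_right (norm_nonneg _) (hg.2 z)
  have h5 := pow_le_pow_left₀ (norm_nonneg _) h4 2
  nlinarith [norm_nonneg f]

theorem hasValueAt_linFrac (ha : ∀ i, a i ∈ NDisk) (hP : StrictlyPositive (pick a b))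
    {g : Disk → N} (hg : g ∈ schur) (i : Fin n) : HasValueAt (linFrac a b g) (a i) (b i) := by
  obtain ⟨h₀, hh₀, e₀⟩ := exists_theta_dvd ha hP i 0
  obtain ⟨h₁, hh₁, e₁⟩ := exists_theta_dvd ha hP i 1
  refine hasValueAt_of_dvd (ha i) ((((hh₀ _).mul (isAnalytic_iff.1 hg.1 _)).add (hh₁ _)).mul
    ((anAt_denom ha hg _).inverse (isUnit_denom ha hP hg _)))
    (Filter.Eventually.of_forall fun ζ => ?_)
  refine (isUnit_denom ha hP hg ζ).mul_right_cancel ?_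
  rw [sub_mul, linFrac_mul_denom ha hP hg, ← mul_assoc, mul_assoc (_ * _),
    Ring.inverse_mul_cancel _ (isUnit_denom ha hP hg ζ), mul_one, denom]
  linear_combination g ζ * e₀ ζ + e₁ ζ

theorem linFrac_injOn (ha : ∀ i, a i ∈ NDisk) (hP : StrictlyPositive (pick a b)) :
    Set.InjOn (linFrac a b) schur := by
  intro g₁ hg₁ g₂ hg₂ h
  obtain ⟨κ, -, hκ, hdet⟩ := exists_theta_det ha hP
  ext1 ζ₀
  refine eq_of_nodal_mul_eq a (isAnalytic_iff.1 hg₁.1 ζ₀) (isAnalytic_iff.1 hg₂.1 ζ₀) fun ζ => ?_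
  refine (hκ ζ).mul_right_cancel ?_
  have h1 := linFrac_mul_denom ha hP hg₁ ζ
  have h2 := linFrac_mul_denom ha hP hg₂ ζ
  rw [h] at h1
  have h3 := hdet ζ
  rw [← nodal] at h3
  rw [denom] at h1 h2
  -- The determinant of `Θ` times `g₁ - g₂` is eliminated from the two equations.
  linear_combination (g₂ ζ - g₁ ζ) * h3 -
    (theta a b ζ 1 0 * g₂ ζ + theta a b ζ 1 1) * h1 +
    (theta a b ζ 1 0 * g₁ ζ + theta a b ζ 1 1) * h2

/-- For a solution `f` of the interpolation problem, Pick's theorem gives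
`|d f - b| ≤ |a - c f|` for the constant coefficients. -/
theorem norm_E_le_of_interpolates (ha : ∀ i, a i ∈ NDisk) (hP : StrictlyPositive (pick a b))
    {f : Disk → N} (hf : f ∈ schur) (hfab : ∀ i, HasValueAt f (a i) (b i)) (z : Disk) :
    ‖E (theta a b z 0 1 - f z * theta a b z 1 1)‖ ≤
      ‖E (theta a b z 0 0 - f z * theta a b z 1 0)‖ := by
  classical
  let φ : ℂ → ℂ := fun w => if h : w ∈ Metric.ball (0 : ℂ) 1 then E (f ⟨w, h⟩) else 0
  have hφ : ∀ ζ : Disk, φ ζ = E (f ζ) := fun ζ => dif_pos ζ.2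
  have hφd : DifferentiableOn ℂ φ (Metric.ball 0 1) := fun w hw => by
    obtain ⟨ψ, hψ, h⟩ := (isAnalytic_iff.1 hf.1 ⟨w, hw⟩).exists_analyticAt_E
    have h1 : ∀ᶠ v in 𝓝 w, φ v = ψ v :=
      eventually_disk_iff (ζ₀ := ⟨w, hw⟩).1 (h.mono fun ζ hζ => (hφ ζ).trans hζ)
    exact ((hψ.congr (h1.mono fun _ hv => hv.symm)).differentiableAt).differentiableWithinAt
  have hφb : ∀ w ∈ Metric.ball (0 : ℂ) 1, ‖φ w‖ ≤ 1 := fun w hw => by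
    rw [hφ ⟨w, hw⟩]
    exact hf.2 _
  have hval : ∀ i, φ (E (a i)) = E (b i) := fun i => by
    obtain ⟨h, g, -, hg⟩ := (hfab i).exists_dvd
    have h1 := congrArg E hg.self_of_nhds
    rw [map_mul, map_sub, map_sub, E_algebraMap, sub_self, zero_mul, sub_eq_zero] at h1
    rw [← h1, ← hφ]
  have h1 := pick_schur_complement hφd hφb (fun i => norm_E_lt_one (ha i))
    (mem_ball_zero_iff.1 z.2) hP.posDef_map
    (fun i j => by rw [Matrix.map_apply, E_pick ha, hval, hval]) (map_pick_mul_map_inv hP)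
    (fun j => rfl)
  have h2 := theta_form ha hP z ![1, -φ z]
    (y := fun j => (1 - φ z * star (φ (E (a j)))) * (1 - z * star (E (a j)))⁻¹) fun j => by
      simp [hval, sub_eq_add_neg]
  have hz : 0 < 1 - ‖(z : ℂ)‖ ^ 2 := by
    have := mem_ball_zero_iff.1 z.2
    nlinarith [norm_nonneg (z : ℂ)]
  have h3 := mul_le_mul_of_nonneg_left h1 hz.le
  rw [← h2, mul_left_comm, mul_inv_cancel₀ hz.ne', mul_one] at h3
  simp only [Matrix.cons_val_zero, Matrix.cons_val_one, one_mul, norm_one, norm_neg] at h3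
  have h4 : ∀ l, E (theta a b z 0 l - f z * theta a b z 1 l) =
      E (theta a b z 0 l) + -φ z * E (theta a b z 1 l) := fun l => by
    rw [map_sub, map_mul, hφ]
    ring
  rw [h4, h4]
  refine abs_le_of_sq_le_sq' ?_ (norm_nonneg _) |>.2
  linarith

/-- Both entries of the row `(1, -f) Θ` are divisible by `∏ (λ - a_i)`; the quotient `(u, w)` of
this row gives `g = -w / u`. -/
theorem linFrac_surjOn (ha : ∀ i, a i ∈ NDisk) (hP : StrictlyPositive (pick a b))
    {f : Disk → N} (hf : f ∈ schur) (hfab : ∀ i, HasValueAt f (a i) (b i)) :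
    ∃ g ∈ schur, linFrac a b g = f := by
  have hfan := isAnalytic_iff.1 hf.1
  obtain ⟨κ, hκ, hκu, hdet⟩ := exists_theta_det ha hP
  have hdvd : ∀ l, ∃ u : Disk → N, (∀ ζ₀, AnAt u ζ₀) ∧
      ∀ ζ : Disk, theta a b ζ 0 l - f ζ * theta a b ζ 1 l = nodal a ζ * u ζ := fun l => by
    refine exists_eq_nodal_mul ha (E_injective_of_strictlyPositive ha hP)
      (fun ζ₀ => (anAt_theta ha 0 l ζ₀).sub ((hfan ζ₀).mul (anAt_theta ha 1 l ζ₀))) fun i => ?_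
    obtain ⟨h, hh, e⟩ := exists_theta_dvd ha hP i l
    obtain ⟨_, g, hg, hfg⟩ := (hfab i).exists_dvd
    refine ⟨fun ζ => h ζ - g ζ * theta a b ζ 1 l, (hh _).sub (hg.mul (anAt_theta ha 1 l _)), ?_⟩
    filter_upwards [hfg] with ζ h1
    linear_combination e ζ - theta a b ζ 1 l * h1
  obtain ⟨u, hu, hu'⟩ := hdvd 0
  obtain ⟨w, hw, hw'⟩ := hdvd 1
  -- These identities come from `(1, -f) Θ adj(Θ) = det(Θ) (1, -f)`.
  have k1 : ∀ ζ, u ζ * theta a b ζ 1 1 - w ζ * theta a b ζ 1 0 = κ ζ := fun ζ =>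
    eq_of_nodal_mul_eq a (f := fun ζ => u ζ * theta a b ζ 1 1 - w ζ * theta a b ζ 1 0)
      (((hu ζ).mul (anAt_theta ha 1 1 ζ)).sub ((hw ζ).mul (anAt_theta ha 1 0 ζ))) (hκ ζ)
      fun ζ => by
        have h3 := hdet ζ
        rw [← nodal] at h3
        linear_combination h3 - theta a b ζ 1 1 * hu' ζ + theta a b ζ 1 0 * hw' ζ
  have k2 : ∀ ζ, u ζ * theta a b ζ 0 1 - w ζ * theta a b ζ 0 0 = f ζ * κ ζ := fun ζ =>
    eq_of_nodal_mul_eq a (f := fun ζ => u ζ * theta a b ζ 0 1 - w ζ * theta a b ζ 0 0)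
      (g := fun ζ => f ζ * κ ζ)
      (((hu ζ).mul (anAt_theta ha 0 1 ζ)).sub ((hw ζ).mul (anAt_theta ha 0 0 ζ)))
      ((hfan ζ).mul (hκ ζ))
      fun ζ => by
        have h3 := hdet ζ
        rw [← nodal] at h3
        linear_combination f ζ * h3 - theta a b ζ 0 1 * hu' ζ + theta a b ζ 0 0 * hw' ζ
  have hle : ∀ ζ, ‖E (w ζ)‖ ≤ ‖E (u ζ)‖ := fun ζ₀ =>
    (hw ζ₀).norm_E_le_of_eventually_ne (hu ζ₀) <|
      (eventually_isUnit_nodal a ζ₀).mono fun ζ hB hne => by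
        have h1 := norm_E_le_of_interpolates ha hP hf hfab ζ
        rw [hu', hw', map_mul, map_mul, norm_mul, norm_mul] at h1
        exact le_of_mul_le_mul_left h1 (norm_pos_iff.2 ((hB hne).map E).ne_zero)
  have huu : ∀ ζ, IsUnit (u ζ) := fun ζ => isUnit_of_E_ne_zero fun h0 => by
    have h1 : E (w ζ) = 0 := norm_le_zero_iff.1 ((hle ζ).trans_eq (by rw [h0, norm_zero]))
    have h2 := congrArg E (k1 ζ)
    rw [map_sub, map_mul, map_mul, h0, h1, zero_mul, zero_mul, sub_self] at h2
    exact ((hκu ζ).map E).ne_zero h2.symm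
  let g : Disk → N := fun ζ => (0 - w ζ) * (u ζ)⁻¹ʳ
  have hgu : ∀ ζ, g ζ * u ζ = -w ζ := fun ζ => by
    simp only [g]
    rw [mul_assoc, Ring.inverse_mul_cancel _ (huu ζ), mul_one, zero_sub]
  have hg : g ∈ schur := by
    refine ⟨isAnalytic_iff.2 fun ζ₀ => ((AnAt.const 0).sub (hw ζ₀)).mul
      ((hu ζ₀).inverse (huu ζ₀)), fun ζ => ?_⟩
    have h1 := congrArg (fun r => ‖E r‖) (hgu ζ)
    simp only [map_mul, map_neg, norm_mul, norm_neg] at h1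
    have h2 : 0 < ‖E (u ζ)‖ := norm_pos_iff.2 ((huu ζ).map E).ne_zero
    have h3 := hle ζ
    rw [← h1] at h3
    exact le_of_mul_le_mul_right (by rwa [one_mul]) h2
  refine ⟨g, hg, funext fun ζ => ?_⟩
  have h1 := linFrac_mul_denom ha hP hg ζ
  refine (isUnit_denom ha hP hg ζ).mul_right_cancel (h1.trans ?_)
  refine (huu ζ).mul_right_cancel ?_
  rw [denom]
  linear_combination (theta a b ζ 0 0 - f ζ * theta a b ζ 1 0) * hgu ζ + k2 ζ - f ζ * k1 ζ

end

end Kondratiev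

end

theorem theorem5p3 (n : ℕ) (a b : Fin n → Kondratiev.N)
    (ha : ∀ i, a i ∈ Kondratiev.NDisk) (hb : ∀ i, b i ∈ Kondratiev.NDisk)
    (hP : Kondratiev.StrictlyPositive (Kondratiev.pick a b)) :
    (∀ i j, IsUnit (1 - a i * star (a j))) ∧
    IsUnit (Kondratiev.pick a b) ∧
    IsUnit (1 - Kondratiev.matA a) ∧
    (∀ z : Kondratiev.Disk, IsUnit (1 - (z : ℂ) • Kondratiev.matA a)) ∧
    (∀ g ∈ Kondratiev.schur, ∀ z : Kondratiev.Disk, IsUnit (Kondratiev.denom a b g z)) ∧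
    Set.BijOn (Kondratiev.linFrac a b) Kondratiev.schur
      {f | f ∈ Kondratiev.schur ∧ ∀ i, Kondratiev.HasValueAt f (a i) (b i)} := by
  refine ⟨fun i j => Kondratiev.isUnit_one_sub_mul_star (ha i) (ha j), hP.isUnit,
    IsUnit.of_mul_eq_one _ (Kondratiev.mul_resolvent_one ha), fun z => ?_,
    fun g hg z => Kondratiev.isUnit_denom ha hP hg z,
    fun g hg => ⟨Kondratiev.linFrac_mem_schur ha hP hg,
      Kondratiev.hasValueAt_linFrac ha hP hg⟩, Kondratiev.linFrac_injOn ha hP,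
    fun f hf => Kondratiev.linFrac_surjOn ha hP hf.1 hf.2⟩
  rw [Kondratiev.algebraMap_smul_matA]
  exact IsUnit.of_mul_eq_one _ (Kondratiev.mul_resolvent_disk ha z)
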